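/- Names. Concept names, role names and individual names are three sorts of finite bit strings. A role is a role name $r$ or its inverse $r^-$, with $(r^-)^-=r$. $\mathcal{ELI}_\bot$ concepts are given by $C,D ::= \top \mid \bot \mid A \mid C\sqcap D \mid \exists r.C$, where $A$ is a concept name and $r$ a role. An $\mathcal{ELHIF}_\bot$ TBox is a finite set of concept inclusions (CIs) $C\sqsubseteq D$ between $\mathcal{ELI}_\bot$ concepts, role inclusions (RIs) $r\sqsubseteq s$ and functionality assertions (FAs) $\mathsf{func}(r)$, in which functional roles have no subroles: if $r\sqsubseteq s\in\mathcal T$, then neither $\mathsf{func}(s)\in\mathcal T$ nor $\mathsf{func}(s^-)\in\mathcal T$. An ABox is a finite set of assertions $A(a)$ and $r(a,b)$ with $A$ a concept name, $r$ a role name and $a,b$ individual names; $\mathsf{ind}(\mathcal A)$ is the set of individual names in $\mathcal A$. The semantics is the usual one, over interpretations in which distinct individual names denote distinct elements; $\mathcal T\models\alpha$ means that every model of $\mathcal T$ satisfies $\alpha$, and $\mathcal A$ is consistent with $\mathcal T$ if they have a common model. A signature $\Sigma$ is a finite set of concept names and role names; a $\Sigma$-object uses only concept and role names from $\Sigma$.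 A 1tCQ is a conjunctive query $q(x)=\exists \mathbf y\,\varphi(x,\mathbf y)$ with exactly one answer variable, where $\varphi$ is a conjunction of atoms $A(z)$ and $r(z,z')$ over the variables $x,\mathbf y$, such that there is no atom $r(z,z)$, the undirected graph with vertex set $\{x\}\cup\mathbf y$ and edges $\{z,z'\}$ for the atoms $r(z,z')$ is a tree, and for distinct variables $z,z'$ there is at most one atom of the form $r(z,z')$ or $r(z',z)$. We write $\mathcal T,\mathcal A\models q(a)$ if in every common model of $\mathcal T$ and $\mathcal A$ there is a match of $q$ that sends $x$ to $a$. Consider the following decision problems, in which $\mathcal T,\mathcal T_1,\mathcal T_2$ range over $\mathcal{ELHIF}_\bot$ TBoxes and $\Sigma$ over signatures, all being part of the input. 1. $\Sigma$-deductive entailment: given $\mathcal T_1,\mathcal T_2,\Sigma$, decide whether $\mathcal T_2\models\alpha$ implies $\mathcal T_1\models\alpha$ for all CIs $\alpha$ between $\Sigma$-$\mathcal{ELI}_\bot$ concepts, all $\Sigma$-RIs $\alpha$ and all $\Sigma$-FAs $\alpha$. 2. $(\Sigma,\Sigma)$-1tCQ entailment: given $\mathcal T_1,\mathcal T_2,\Sigma$,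 decide whether for every $\Sigma$-ABox $\mathcal A$ that is consistent with $\mathcal T_1$ and with $\mathcal T_2$, every $\Sigma$-1tCQ $q(x)$ and every $a\in\mathsf{ind}(\mathcal A)$, $\mathcal T_2,\mathcal A\models q(a)$ implies $\mathcal T_1,\mathcal A\models q(a)$. 3. 1tCQ evaluation: given $\mathcal T$, an ABox $\mathcal A$, a 1tCQ $q(x)$ and $a\in\mathsf{ind}(\mathcal A)$, decide whether $\mathcal T,\mathcal A\models q(a)$. Proposition. $\Sigma$-deductive entailment can be decided in polynomial time (in the size of $\mathcal T_1,\mathcal T_2,\Sigma$) given access to oracles for $(\Sigma,\Sigma)$-1tCQ entailment and 1tCQ evaluation. -/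

import Mathlib

namespace ELHIF

/-! ## Machine model: a structured programming language over binary trees, with oracles -/

/-- Binary trees (S-expressions), the data on which programs compute. -/
inductive Data : Type
  | nil : Data
  | node (l r : Data) : Data

namespace Data

/-- Size of a tree: its number of nodes, the leaves included. -/
def size : Data → ℕ
  | nil => 1
  | node l r => l.size + r.size + 1

def hd : Data → Data
  | nil => nil
  | node l _ => l

def tl : Data → Data
  | nil => nil
  | node _ r => r

/-- Unary numerals, used as constructor tags. -/
def num : ℕ → Data
  | 0 => nil
  | k + 1 => node nil (num k)

end Data

/-- A store assigns a tree to every program variable. -/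
abbrev Store := ℕ → Data

/-- Expressions over program variables. -/
inductive Expr : Type
  | var (x : ℕ) : Expr
  | nil : Expr
  | cons (e f : Expr) : Expr
  | hd (e : Expr) : Expr
  | tl (e : Expr) : Expr

def Expr.eval (s : Store) : Expr → Data
  | .var x => s x
  | .nil => .nil
  | .cons e f => .node (e.eval s) (f.eval s)
  | .hd e => (e.eval s).hd
  | .tl e => (e.eval s).tl

/-- Programs with access to oracles that are indexed by `ι`. The value `nil` counts as false,
every other value as true. -/
inductive Prog (ι : Type) : Type
  | skip : Prog ι
  | assign (x : ℕ) (e : Expr) : Prog ι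
  | seq (c d : Prog ι) : Prog ι
  | ite (x : ℕ) (c d : Prog ι) : Prog ι
  | loop (x : ℕ) (c : Prog ι) : Prog ι
  | ask (i : ι) (x : ℕ) (e : Expr) : Prog ι

/-- `Exec O c s s' t`: started in store `s` with oracles `O`, the program `c` halts in store `s'`
after `t` time units. Tests cost one unit. An assignment costs the size of the assigned value (plus
one) and an oracle call costs the size of the question (plus one), so that `t` bounds the size
of everything that is built or asked. This is, up to a polynomial, the time of a multitape oracle
Turing machine. -/
inductive Exec {ι : Type} (O : ι → Set Data) : Prog ι → Store → Store → ℕ → Prop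
  | skip (s : Store) : Exec O .skip s s 1
  | assign (x : ℕ) (e : Expr) (s : Store) :
      Exec O (.assign x e) s (Function.update s x (e.eval s)) ((e.eval s).size + 1)
  | seq {c d : Prog ι} {s s' s'' : Store} {t t' : ℕ} :
      Exec O c s s' t → Exec O d s' s'' t' → Exec O (.seq c d) s s'' (t + t')
  | ite_true {x : ℕ} {c d : Prog ι} {s s' : Store} {t : ℕ} :
      s x ≠ .nil → Exec O c s s' t → Exec O (.ite x c d) s s' (t + 1)
  | ite_false {x : ℕ} {c d : Prog ι} {s s' : Store} {t : ℕ} :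
      s x = .nil → Exec O d s s' t → Exec O (.ite x c d) s s' (t + 1)
  | loop_true {x : ℕ} {c : Prog ι} {s s' s'' : Store} {t t' : ℕ} :
      s x ≠ .nil → Exec O c s s' t → Exec O (.loop x c) s' s'' t' →
        Exec O (.loop x c) s s'' (t + t' + 1)
  | loop_false {x : ℕ} {c : Prog ι} {s : Store} :
      s x = .nil → Exec O (.loop x c) s s 1
  | ask_yes {i : ι} {x : ℕ} {e : Expr} {s : Store} :
      e.eval s ∈ O i →
        Exec O (.ask i x e) s (Function.update s x (.node .nil .nil)) ((e.eval s).size + 1)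
  | ask_no {i : ι} {x : ℕ} {e : Expr} {s : Store} :
      e.eval s ∉ O i →
        Exec O (.ask i x e) s (Function.update s x .nil) ((e.eval s).size + 1)

/-- The input is stored in variable `0`; all other variables are empty. -/
def Store.init (d : Data) : Store := fun x => if x = 0 then d else .nil

/-- Injective encodings by trees. -/
class Coded (α : Type) where
  code : α → Data
  code_inj : Function.Injective code

open Coded (code code_inj)

/-- A decision problem: a type of encoded instances and the set of its yes-instances. -/
structure Problem where
  Inst : Type
  coded : Coded Inst
  Yes : Inst → Prop

/-- The set of encodings of yes-instances. -/
def Problem.language (P : Problem) : Set Data := {d | ∃ i : P.Inst, P.Yes i ∧ P.coded.code i = d}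

/-- `P` can be decided in polynomial time given access to oracles for the problems `Q i`: one
program, and one polynomial in the size of the input, work for all instances. The answer is the
final value of variable `0`. -/
def PolyTimeDecidableGiven {ι : Type} (Q : ι → Problem) (P : Problem) : Prop :=
  ∃ (c : Prog ι) (p : Polynomial ℕ), ∀ i : P.Inst, ∃ (s : Store) (t : ℕ),
    Exec (fun j => (Q j).language) c (Store.init (P.coded.code i)) s t ∧
    t ≤ p.eval (P.coded.code i).size ∧
    (s 0 ≠ .nil ↔ P.Yes i)

/-! ## Encodings of basic types -/

theorem Data.num_inj : Function.Injective Data.num := by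
  intro a
  induction a with
  | zero => intro b h; cases b with
    | zero => rfl
    | succ b => simp [Data.num] at h
  | succ a ih => intro b h; cases b with
    | zero => simp [Data.num] at h
    | succ b => simp only [Data.num, Data.node.injEq, true_and] at h; rw [ih h]

def codeBool (b : Bool) : Data := Data.num b.toNat

instance : Coded Bool where
  code := codeBool
  code_inj := by
    intro a b h
    have := Data.num_inj h
    revert this
    cases a <;> cases b <;> simp

def codeList {α : Type} [Coded α] : List α → Data
  | [] => .nil
  | a :: l => .node (code a) (codeList l)

instance {α : Type} [Coded α] : Coded (List α) where
  code := codeList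
  code_inj := by
    intro l
    induction l with
    | nil => intro m h; cases m with
      | nil => rfl
      | cons b m => simp [codeList] at h
    | cons a l ih => intro m h; cases m with
      | nil => simp [codeList] at h
      | cons b m =>
        simp only [codeList, Data.node.injEq] at h
        rw [code_inj h.1, ih h.2]

/-! ## Syntax and semantics of the description logic -/

/-- Names are finite bit strings; the three sorts of names are kept apart by their positions. -/
abbrev ConceptName := List Bool
abbrev RoleName := List Bool
abbrev IndName := List Bool

/-- A role is a role name or the inverse of a role name. -/
inductive Role : Type
  | fwd (r : RoleName) : Role
  | bwd (r : RoleName) : Role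

namespace Role

/-- The inverse of a role, with `(r⁻)⁻` identified with `r`. -/
def inv : Role → Role
  | fwd r => bwd r
  | bwd r => fwd r

def name : Role → RoleName
  | fwd r => r
  | bwd r => r

end Role

/-- `ELI⊥` concepts. -/
inductive Concept : Type
  | top : Concept
  | bot : Concept
  | atom (A : ConceptName) : Concept
  | and (C D : Concept) : Concept
  | ex (r : Role) (C : Concept) : Concept

/-- The members of a TBox: concept inclusions, role inclusions, functionality assertions. -/
inductive Stmt : Type
  | ci (C D : Concept) : Stmt
  | ri (r s : Role) : Stmt
  | func (r : Role) : Stmt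

/-- An `ELHIF⊥` TBox: a finite set of statements, given as a list, in which functional roles have no
subroles. An inclusion `r ⊑ s` makes `r` a subrole of `s`, and `r⁻` a subrole of `s⁻`. -/
structure TBox where
  stmts : List Stmt
  no_subrole : ∀ r s : Role, Stmt.ri r s ∈ stmts →
    Stmt.func s ∉ stmts ∧ Stmt.func s.inv ∉ stmts

/-- Interpretations. The standard name assumption is rendered up to isomorphism: distinct individual
names denote distinct elements. In particular the domain is non-empty. -/
structure Interp where
  Dom : Type
  con : ConceptName → Set Dom
  rol : RoleName → Dom → Dom → Prop
  ind : IndName → Dom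
  ind_inj : Function.Injective ind

namespace Interp

/-- `(d, e) ∈ r^I` -/
def role (I : Interp) : Role → I.Dom → I.Dom → Prop
  | .fwd r, d, e => I.rol r d e
  | .bwd r, d, e => I.rol r e d

/-- `C^I` -/
def ext (I : Interp) : Concept → Set I.Dom
  | .top => Set.univ
  | .bot => ∅
  | .atom A => I.con A
  | .and C D => I.ext C ∩ I.ext D
  | .ex r C => {d | ∃ e, I.role r d e ∧ e ∈ I.ext C}

def Sat (I : Interp) : Stmt → Prop
  | .ci C D => I.ext C ⊆ I.ext D
  | .ri r s => ∀ d e, I.role r d e → I.role s d e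
  | .func r => ∀ d e e', I.role r d e → I.role r d e' → e = e'

def ModelOfTBox (I : Interp) (T : TBox) : Prop := ∀ α ∈ T.stmts, I.Sat α

end Interp

/-- `T ⊨ α` -/
def TBox.Entails (T : TBox) (α : Stmt) : Prop := ∀ I : Interp, I.ModelOfTBox T → I.Sat α

/-- Finite signatures: finite sets of concept names and of role names, given as lists. -/
structure Sig where
  concepts : List ConceptName
  roles : List RoleName

def Role.Over (S : Sig) (r : Role) : Prop := r.name ∈ S.roles

def Concept.Over (S : Sig) : Concept → Prop
  | .top => True
  | .bot => True
  | .atom A => A ∈ S.concepts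
  | .and C D => C.Over S ∧ D.Over S
  | .ex r C => r.Over S ∧ C.Over S

def Stmt.Over (S : Sig) : Stmt → Prop
  | .ci C D => C.Over S ∧ D.Over S
  | .ri r s => r.Over S ∧ s.Over S
  | .func r => r.Over S

/-- `T₁` `S`-deductively entails `T₂`. -/
def DeductivelyEntails (S : Sig) (T₁ T₂ : TBox) : Prop :=
  ∀ α : Stmt, α.Over S → T₂.Entails α → T₁.Entails α

/-! ## ABoxes and tree-shaped conjunctive queries -/

inductive Assertion : Type
  | con (A : ConceptName) (a : IndName) : Assertion
  | rol (r : RoleName) (a b : IndName) : Assertion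

/-- An ABox is a finite set of assertions, given as a list. -/
abbrev ABox := List Assertion

def Assertion.inds : Assertion → Set IndName
  | .con _ a => {a}
  | .rol _ a b => {a, b}

def Assertion.Over (S : Sig) : Assertion → Prop
  | .con A _ => A ∈ S.concepts
  | .rol r _ _ => r ∈ S.roles

/-- `ind(A)` -/
def ABox.inds (A : ABox) : Set IndName := {a | ∃ α ∈ A, a ∈ Assertion.inds α}

def ABox.Over (S : Sig) (A : ABox) : Prop := ∀ α ∈ A, Assertion.Over S α

def Interp.SatAssertion (I : Interp) : Assertion → Prop
  | .con A a => I.ind a ∈ I.con A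
  | .rol r a b => I.rol r (I.ind a) (I.ind b)

def Interp.ModelOfABox (I : Interp) (A : ABox) : Prop := ∀ α ∈ A, I.SatAssertion α

def ABox.ConsistentWith (A : ABox) (T : TBox) : Prop :=
  ∃ I : Interp, I.ModelOfTBox T ∧ I.ModelOfABox A

abbrev Var := List Bool

/-- Atoms of conjunctive queries. -/
inductive QAtom : Type
  | con (A : ConceptName) (z : Var) : QAtom
  | rol (r : RoleName) (z z' : Var) : QAtom

def QAtom.vars : QAtom → Set Var
  | .con _ z => {z}
  | .rol _ z z' => {z, z'}

def QAtom.Over (S : Sig) : QAtom → Prop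
  | .con A _ => A ∈ S.concepts
  | .rol r _ _ => r ∈ S.roles

/-- A 1tCQ: a conjunctive query `∃ ex. ⋀ atoms` with exactly one answer variable `ans`
that is tree-shaped. -/
structure OneTCQ where
  ans : Var
  ex : List Var
  atoms : List QAtom
  ans_not_ex : ans ∉ ex
  vars_sub : ∀ α ∈ atoms, ∀ z ∈ QAtom.vars α, z = ans ∨ z ∈ ex
  /-- no loops -/
  no_loop : ∀ r z, QAtom.rol r z z ∉ atoms
  /-- the undirected graph on all variables is a tree -/
  tree : (SimpleGraph.fromRel
    (fun u v : {z : Var // z = ans ∨ z ∈ ex} => ∃ r, QAtom.rol r u v ∈ atoms)).IsTree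
  /-- no multi-edges: at most one role atom between two variables, in whichever direction -/
  no_multi_edge : ∀ r s z z' u u', QAtom.rol r z z' ∈ atoms → QAtom.rol s u u' ∈ atoms →
    s(z, z') = s(u, u') → QAtom.rol r z z' = QAtom.rol s u u'

def OneTCQ.Over (S : Sig) (q : OneTCQ) : Prop := ∀ α ∈ q.atoms, QAtom.Over S α

def Interp.SatAtom (I : Interp) (π : Var → I.Dom) : QAtom → Prop
  | .con A z => π z ∈ I.con A
  | .rol r z z' => I.rol r (π z) (π z')

/-- `I ⊨ q(a)`: there is a match that sends the answer variable to `a`. -/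
def Interp.SatQuery (I : Interp) (q : OneTCQ) (a : IndName) : Prop :=
  ∃ π : Var → I.Dom, π q.ans = I.ind a ∧ ∀ α ∈ q.atoms, I.SatAtom π α

/-- `T, A ⊨ q(a)`: `a` is a certain answer to `q` over `A` given `T`. -/
def CertainAnswer (T : TBox) (A : ABox) (q : OneTCQ) (a : IndName) : Prop :=
  ∀ I : Interp, I.ModelOfTBox T → I.ModelOfABox A → I.SatQuery q a

/-- `T₁` `(SA, SQ)`-1tCQ entails `T₂`. -/
def OneTCQEntails (SA SQ : Sig) (T₁ T₂ : TBox) : Prop :=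
  ∀ A : ABox, A.Over SA → A.ConsistentWith T₁ → A.ConsistentWith T₂ →
    ∀ q : OneTCQ, q.Over SQ → ∀ a ∈ A.inds,
      CertainAnswer T₂ A q a → CertainAnswer T₁ A q a

/-! ## Encodings of the syntactic objects -/

def codeRole : Role → Data
  | .fwd r => .node (.num 0) (code r)
  | .bwd r => .node (.num 1) (code r)

instance : Coded Role where
  code := codeRole
  code_inj := by
    intro a b h
    cases a <;> cases b <;> simp only [codeRole, Data.node.injEq, Data.num_inj.eq_iff,
      code_inj.eq_iff] at h <;> simp_all

def codeConcept : Concept → Data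
  | .top => .node (.num 0) .nil
  | .bot => .node (.num 1) .nil
  | .atom A => .node (.num 2) (code A)
  | .and C D => .node (.num 3) (.node (codeConcept C) (codeConcept D))
  | .ex r C => .node (.num 4) (.node (code r) (codeConcept C))

instance : Coded Concept where
  code := codeConcept
  code_inj := by
    intro a
    induction a with
    | and C D hC hD =>
      intro b h
      cases b <;> simp only [codeConcept, Data.node.injEq, Data.num_inj.eq_iff] at h
      case and C' D' => rw [hC h.2.1, hD h.2.2]
      all_goals simp_all
    | ex r C hC =>
      intro b h
      cases b <;> simp only [codeConcept, Data.node.injEq, Data.num_inj.eq_iff,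
        code_inj.eq_iff] at h
      case ex r' C' => rw [h.2.1, hC h.2.2]
      all_goals simp_all
    | _ =>
      intro b h
      cases b <;> simp only [codeConcept, Data.node.injEq, Data.num_inj.eq_iff,
        code_inj.eq_iff] at h <;> simp_all

def codeStmt : Stmt → Data
  | .ci C D => .node (.num 0) (.node (code C) (code D))
  | .ri r s => .node (.num 1) (.node (code r) (code s))
  | .func r => .node (.num 2) (code r)

instance : Coded Stmt where
  code := codeStmt
  code_inj := by
    intro a b h
    cases a <;> cases b <;> simp only [codeStmt, Data.node.injEq, Data.num_inj.eq_iff,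
      code_inj.eq_iff] at h <;> simp_all

instance : Coded TBox where
  code := fun T => code T.stmts
  code_inj := by
    rintro ⟨a, _⟩ ⟨b, _⟩ h
    have : a = b := code_inj h
    subst this
    rfl

instance : Coded Sig where
  code := fun S => .node (code S.concepts) (code S.roles)
  code_inj := by
    rintro ⟨a, b⟩ ⟨c, d⟩ h
    simp only [Data.node.injEq, code_inj.eq_iff] at h
    simp_all

def codeAssertion : Assertion → Data
  | .con A a => .node (.num 0) (.node (code A) (code a))
  | .rol r a b => .node (.num 1) (.node (code r) (.node (code a) (code b)))

instance : Coded Assertion where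
  code := codeAssertion
  code_inj := by
    intro a b h
    cases a <;> cases b <;> simp only [codeAssertion, Data.node.injEq, Data.num_inj.eq_iff,
      code_inj.eq_iff] at h <;> simp_all

def codeQAtom : QAtom → Data
  | .con A z => .node (.num 0) (.node (code A) (code z))
  | .rol r z z' => .node (.num 1) (.node (code r) (.node (code z) (code z')))

instance : Coded QAtom where
  code := codeQAtom
  code_inj := by
    intro a b h
    cases a <;> cases b <;> simp only [codeQAtom, Data.node.injEq, Data.num_inj.eq_iff,
      code_inj.eq_iff] at h <;> simp_all

instance : Coded OneTCQ where
  code := fun q => .node (code q.ans) (.node (code q.ex) (code q.atoms))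
  code_inj := by
    rintro ⟨a, b, c, _, _, _, _, _⟩ ⟨a', b', c', _, _, _, _, _⟩ h
    simp only [Data.node.injEq, code_inj.eq_iff] at h
    obtain ⟨rfl, rfl, rfl⟩ := h
    rfl

/-! ## The three decision problems -/

/-- Two TBoxes and a signature. -/
structure EntailmentInst where
  T₁ : TBox
  T₂ : TBox
  S : Sig

instance : Coded EntailmentInst where
  code := fun i => .node (code i.T₁) (.node (code i.T₂) (code i.S))
  code_inj := by
    rintro ⟨a, b, c⟩ ⟨a', b', c'⟩ h
    simp only [Data.node.injEq, code_inj.eq_iff] at h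
    obtain ⟨rfl, rfl, rfl⟩ := h
    rfl

/-- A TBox, an ABox, a 1tCQ, and an individual of the ABox. -/
structure EvaluationInst where
  T : TBox
  A : ABox
  q : OneTCQ
  a : IndName
  a_mem : a ∈ A.inds

instance : Coded EvaluationInst where
  code := fun i => .node (code i.T) (.node (code i.A) (.node (code i.q) (code i.a)))
  code_inj := by
    rintro ⟨a, b, c, d, _⟩ ⟨a', b', c', d', _⟩ h
    simp only [Data.node.injEq, code_inj.eq_iff] at h
    obtain ⟨rfl, rfl, rfl, rfl⟩ := h
    rfl

/-- Given `T₁`, `T₂`, `S`: does `T₁` `S`-deductively entail `T₂`? -/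
def deductiveEntailment : Problem where
  Inst := EntailmentInst
  coded := inferInstance
  Yes i := DeductivelyEntails i.S i.T₁ i.T₂

/-- Given `T₁`, `T₂`, `S`: does `T₁` `(S, S)`-1tCQ entail `T₂`? -/
def oneTCQEntailment : Problem where
  Inst := EntailmentInst
  coded := inferInstance
  Yes i := OneTCQEntails i.S i.S i.T₁ i.T₂

/-- Given `T`, `A`, `q`, `a`: is `a` a certain answer to `q` over `A` given `T`? -/
def oneTCQEvaluation : Problem where
  Inst := EvaluationInst
  coded := inferInstance
  Yes i := CertainAnswer i.T i.A i.q i.a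

end ELHIF

namespace ELHIF

open Coded (code code_inj)

/-! ## Functions computable in polynomial time with oracles -/

/-! A consequence over Σ is a CI, an RI or an FA. There are only polynomially many Σ-RIs and Σ-FAs,
and each is tested by query evaluation with a fresh concept name B. `func(r)` follows from T iff
B(a) is certain over {r(a,b), r(a,c)}, i.e. iff this ABox is inconsistent with T; r ⊑ s follows iff
∃y (s(x,y) ∧ B(y)) is certain at a over {r(a,b), B(b)} (`entails_func_iff`, `entails_ri_iff`).

The CIs are left to the 1tCQ entailment oracle. 1tCQs express exactly the ⊥-free concepts
(`exists_query_of_concept`, `exists_concept_of_query`), and the oracle considers only ABoxes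
consistent with both TBoxes, so contradictions are invisible to it. Hence ⊥ is simulated by B
(`TBox.tame`): a right-hand side containing ⊥ becomes B, and B implies all relevant concept names,
spreads along all relevant roles and has successors in B for all of them; a second fresh name X
stands for ⊤. In a model of a tamed TBox the elements of B satisfy every relevant ⊥-free concept,
and the rest is closed under roles and yields models of the original TBox (`mem_ext_of_mem_con`,
`consistentPart_modelOfTBox`).

The core is `deductivelyEntails_iff`. From queries to CIs: if C holds at d in a model of T₁,
finitely many facts witness this and form an ABox. Only functionality can make the tamed T₂
inconsistent with it, and the FA tests exclude that; the oracle then yields D at d, or a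
contradiction through the query B(x) if D contains ⊥. From CIs to queries: the part outside B of a
model of the tamed T₁ extends to a canonical model of T₂, where each concept at an old element is
forced by a single Σ-concept true there before (`exists_canonicalModel`). A CI of T₂ then transfers
the query to T₁. That functional roles have no subroles is what keeps the canonical model
functional.

The reduction is computed with loops and folds over trees (`Computes`). Parsing is avoided:
occurrences of ⊥ are recognized by an evaluation query, and names are collected by reading every
subtree of the input as a bit string, so that a string as long as the input is fresh. -/

theorem eval_mono_nat (p : Polynomial ℕ) {m n : ℕ} (h : m ≤ n) : p.eval m ≤ p.eval n := by
  rw [Polynomial.eval_eq_sum, Polynomial.eval_eq_sum]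
  exact Finset.sum_le_sum fun i _ => Nat.mul_le_mul_left _ (Nat.pow_le_pow_left h i)

namespace Data

theorem size_hd_le (d : Data) : d.hd.size ≤ d.size := by
  cases d <;> simp only [hd, size] <;> omega

theorem size_tl_le (d : Data) : d.tl.size ≤ d.size := by
  cases d <;> simp only [tl, size] <;> omega

end Data

/-- `f` is computed in polynomial time, in place on any variable `k`, by a program that does not
change the variables below `k`. -/
def Computes {ι : Type} (O : ι → Set Data) (f : Data → Data) : Prop :=
  ∃ p : Polynomial ℕ, (∀ d, (f d).size ≤ p.eval d.size) ∧ ∀ k : ℕ, ∃ c : Prog ι, ∀ s : Store,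
    ∃ (s' : Store) (t : ℕ), Exec O c s s' t ∧ s' k = f (s k) ∧ (∀ j < k, s' j = s j) ∧
      t ≤ p.eval (s k).size

namespace Computes

variable {ι : Type} {O : ι → Set Data}

theorem of_expr {f : Data → Data} (e : ℕ → Expr) (he : ∀ k s, (e k).eval s = f (s k))
    {p : Polynomial ℕ} (hp : ∀ d, (f d).size ≤ p.eval d.size) : Computes O f := by
  refine ⟨p + 1, fun d => by simpa using (hp d).trans (Nat.le_succ _), fun k =>
    ⟨.assign k (e k), fun s => ⟨_, _, .assign k (e k) s, ?_, ?_, ?_⟩⟩⟩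
  · simp [he]
  · intro j hj
    simp [hj.ne]
  · simpa [he] using hp (s k)

theorem id : Computes O fun d => d :=
  of_expr .var (fun _ _ => rfl) (p := .X) (by simp)

theorem hd_fun : Computes O Data.hd :=
  of_expr (fun k => .hd (.var k)) (fun _ _ => rfl) (p := .X) (by simpa using Data.size_hd_le)

theorem tl_fun : Computes O Data.tl :=
  of_expr (fun k => .tl (.var k)) (fun _ _ => rfl) (p := .X) (by simpa using Data.size_tl_le)

theorem nil : Computes O fun _ => .nil :=
  of_expr (fun _ => .nil) (fun _ _ => rfl) (p := 1) (by simp [Data.size])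

theorem comp {f g : Data → Data} (hg : Computes O g) (hf : Computes O f) :
    Computes O fun d => g (f d) := by
  obtain ⟨p, hp, hf⟩ := hf
  obtain ⟨q, hq, hg⟩ := hg
  refine ⟨p + q.comp p, fun d => ?_, fun k => ?_⟩
  · simpa using ((hq _).trans (eval_mono_nat q (hp d))).trans (Nat.le_add_left _ _)
  · obtain ⟨c, hc⟩ := hf k
    obtain ⟨c', hc'⟩ := hg k
    refine ⟨.seq c c', fun s => ?_⟩
    obtain ⟨s', t, h, hk, hj, ht⟩ := hc s
    obtain ⟨s'', t', h', hk', hj', ht'⟩ := hc' s'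
    refine ⟨s'', _, .seq h h', by rw [hk', hk], fun j hjk => by rw [hj' j hjk, hj j hjk], ?_⟩
    rw [hk] at ht'
    have := eval_mono_nat q (hp (s k))
    simp only [Polynomial.eval_add, Polynomial.eval_comp]
    omega

theorem hd {f : Data → Data} (hf : Computes O f) : Computes O fun d => (f d).hd := hd_fun.comp hf

theorem tl {f : Data → Data} (hf : Computes O f) : Computes O fun d => (f d).tl := tl_fun.comp hf

theorem node {f g : Data → Data} (hf : Computes O f) (hg : Computes O g) :
    Computes O fun d => .node (f d) (g d) := by
  obtain ⟨p, hp, hf⟩ := hf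
  obtain ⟨q, hq, hg⟩ := hg
  refine ⟨2 * p + 2 * q + 2 * .X + 4, fun d => ?_, fun k => ?_⟩
  · have := hp d
    have := hq d
    simp only [Data.size, Polynomial.eval_add, Polynomial.eval_mul, Polynomial.eval_ofNat,
      Polynomial.eval_X]
    omega
  -- Variable `k` keeps the input for `g` while `f` runs at `k + 1`, and both survive the run of `g`
  -- at `k + 2`.
  · obtain ⟨c, hc⟩ := hf (k + 1)
    obtain ⟨c', hc'⟩ := hg (k + 2)
    refine ⟨.seq (.assign (k + 1) (.var k)) (.seq c (.seq (.assign (k + 2) (.var k)) (.seq c'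
      (.assign k (.cons (.var (k + 1)) (.var (k + 2))))))), fun s => ?_⟩
    obtain ⟨s₁, t₁, h₁, hk₁, hj₁, ht₁⟩ := hc (Function.update s (k + 1) (s k))
    obtain ⟨s₂, t₂, h₂, hk₂, hj₂, ht₂⟩ := hc' (Function.update s₁ (k + 2) (s₁ k))
    have e₁ : s₁ k = s k := by simp [hj₁ k (by omega)]
    have e₂ : s₂ (k + 1) = f (s k) := by
      rw [hj₂ (k + 1) (by omega), Function.update_of_ne (by omega), hk₁, Function.update_self]
    have e₃ : s₂ (k + 2) = g (s k) := by rw [hk₂, Function.update_self, e₁]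
    refine ⟨_, _, .seq (.assign _ _ _) (.seq h₁ (.seq (.assign _ _ _) (.seq h₂ (.assign _ _ _)))),
      ?_, ?_, ?_⟩
    · simp [Expr.eval, e₂, e₃]
    · intro j hj
      rw [Function.update_of_ne hj.ne, hj₂ j (by omega), Function.update_of_ne (by omega),
        hj₁ j (by omega), Function.update_of_ne (by omega)]
    · simp only [Function.update_self, e₁] at ht₁ ht₂
      have := hp (s k)
      have := hq (s k)
      simp only [Expr.eval, Data.size, Polynomial.eval_add, Polynomial.eval_mul,
        Polynomial.eval_ofNat, Polynomial.eval_X, e₁, e₂, e₃]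
      omega

theorem const (d : Data) : Computes O fun _ => d := by
  induction d with
  | nil => exact nil
  | node l r hl hr => exact hl.node hr

open Classical in
theorem ite {f g h : Data → Data} (hf : Computes O f) (hg : Computes O g) (hh : Computes O h) :
    Computes O fun d => if f d = .nil then h d else g d := by
  obtain ⟨p, hp, hf⟩ := hf
  obtain ⟨q, hq, hg⟩ := hg
  obtain ⟨r, hr, hh⟩ := hh
  refine ⟨p + q + r + .X + 2, fun d => ?_, fun k => ?_⟩
  · have := hq d
    have := hr d
    simp only [Polynomial.eval_add, Polynomial.eval_ofNat, Polynomial.eval_X]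
    split <;> omega
  · obtain ⟨c₁, hc₁⟩ := hf (k + 1)
    obtain ⟨c₂, hc₂⟩ := hg k
    obtain ⟨c₃, hc₃⟩ := hh k
    refine ⟨.seq (.assign (k + 1) (.var k)) (.seq c₁ (.ite (k + 1) c₂ c₃)), fun s => ?_⟩
    obtain ⟨s₁, t₁, h₁, hk₁, hj₁, ht₁⟩ := hc₁ (Function.update s (k + 1) (s k))
    have e₁ : s₁ k = s k := by simp [hj₁ k (by omega)]
    have e₂ : ∀ j < k, s₁ j = s j := fun j hj => by
      rw [hj₁ j (by omega), Function.update_of_ne (by omega)]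
    simp only [Function.update_self] at hk₁ ht₁
    simp only [Polynomial.eval_add, Polynomial.eval_ofNat, Polynomial.eval_X]
    by_cases hnil : f (s k) = .nil
    · obtain ⟨s₂, t₂, h₂, hk₂, hj₂, ht₂⟩ := hc₃ s₁
      refine ⟨s₂, _, .seq (.assign _ _ _) (.seq h₁ (.ite_false (by rw [hk₁, hnil]) h₂)),
        by simp [hnil, hk₂, e₁], fun j hj => by rw [hj₂ j hj, e₂ j hj], ?_⟩
      rw [e₁] at ht₂
      simp only [Expr.eval]
      omega
    · obtain ⟨s₂, t₂, h₂, hk₂, hj₂, ht₂⟩ := hc₂ s₁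
      refine ⟨s₂, _, .seq (.assign _ _ _) (.seq h₁ (.ite_true (by rwa [hk₁]) h₂)),
        by simp [hnil, hk₂, e₁], fun j hj => by rw [hj₂ j hj, e₂ j hj], ?_⟩
      rw [e₁] at ht₂
      simp only [Expr.eval]
      omega

open Classical in
theorem ask (i : ι) {f : Data → Data} (hf : Computes O f) :
    Computes O fun d => if f d ∈ O i then .node .nil .nil else .nil := by
  obtain ⟨p, hp, hf⟩ := hf
  refine ⟨2 * p + 3, fun d => ?_, fun k => ?_⟩
  · simp only [Polynomial.eval_add, Polynomial.eval_mul, Polynomial.eval_ofNat]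
    split <;> simp only [Data.size] <;> omega
  · obtain ⟨c, hc⟩ := hf k
    refine ⟨.seq c (.ask i k (.var k)), fun s => ?_⟩
    obtain ⟨s₁, t₁, h₁, hk₁, hj₁, ht₁⟩ := hc s
    have := hp (s k)
    have hkeep : ∀ v, ∀ j < k, Function.update s₁ k v j = s j := fun v j hj => by
      rw [Function.update_of_ne hj.ne, hj₁ j hj]
    simp only [Polynomial.eval_add, Polynomial.eval_mul, Polynomial.eval_ofNat]
    by_cases hO : f (s k) ∈ O i
    · refine ⟨_, _, .seq h₁ (.ask_yes (by simpa [Expr.eval, hk₁])), by simp [hO], hkeep _, ?_⟩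
      simp only [Expr.eval, hk₁]
      omega
    · refine ⟨_, _, .seq h₁ (.ask_no (by simpa [Expr.eval, hk₁])), by simp [hO], hkeep _, ?_⟩
      simp only [Expr.eval, hk₁]
      omega

/-- The polynomial `b` has to bound the intermediate states as well as the number of rounds:
polynomial growth in a single step does not by itself keep an iteration polynomial. -/
theorem loop {init test step F : Data → Data} (hinit : Computes O init) (htest : Computes O test)
    (hstep : Computes O step) (b : Polynomial ℕ)
    (hF : ∀ d, ∃ m ≤ b.eval d.size, (∀ j < m, test (step^[j] (init d)) ≠ .nil) ∧
      test (step^[m] (init d)) = .nil ∧ (∀ j ≤ m, (step^[j] (init d)).size ≤ b.eval d.size) ∧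
      F d = step^[m] (init d)) : Computes O F := by
  obtain ⟨r, hr, hinit⟩ := hinit
  obtain ⟨p, hp, htest⟩ := htest
  obtain ⟨q, hq, hstep⟩ := hstep
  refine ⟨r + b + p.comp b + b * (q.comp b + b + p.comp b + 2) + 2, fun d => ?_, fun k => ?_⟩
  · obtain ⟨m, -, -, -, hs, hFd⟩ := hF d
    have := hs m le_rfl
    simp only [Polynomial.eval_add, Polynomial.eval_mul, Polynomial.eval_ofNat, hFd]
    omega
  obtain ⟨ci, hci⟩ := hinit k
  obtain ⟨ct, hct⟩ := htest (k + 1)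
  obtain ⟨cs, hcs⟩ := hstep k
  let body : Prog ι := .seq cs (.seq (.assign (k + 1) (.var k)) ct)
  -- Invariant: variable `k + 1` holds the test value of the state that is stored in `k`.
  have loop : ∀ (N m : ℕ) (s : Store), s (k + 1) = test (s k) →
      (∀ j < m, test (step^[j] (s k)) ≠ .nil) → test (step^[m] (s k)) = .nil →
      (∀ j ≤ m, (step^[j] (s k)).size ≤ N) →
      ∃ s' t, Exec O (.loop (k + 1) body) s s' t ∧ s' k = step^[m] (s k) ∧
        (∀ j < k, s' j = s j) ∧ t ≤ m * (q.eval N + N + p.eval N + 2) + 1 := by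
    intro N m
    induction m with
    | zero =>
      intro s h1 _ h2 _
      exact ⟨s, 1, .loop_false (by rw [h1]; exact h2), rfl, fun _ _ => rfl, by omega⟩
    | succ m ih =>
      intro s h1 h2 h3 h4
      obtain ⟨s₁, t₁, e₁, hk₁, hj₁, ht₁⟩ := hcs s
      obtain ⟨s₂, t₂, e₂, hk₂, hj₂, ht₂⟩ := hct (Function.update s₁ (k + 1) (s₁ k))
      have a₁ : s₂ k = step (s k) := by
        rw [hj₂ k (by omega), Function.update_of_ne (by omega), hk₁]
      have a₂ : s₂ (k + 1) = test (s₂ k) := by rw [hk₂, Function.update_self, hk₁, a₁]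
      obtain ⟨s₃, t₃, e₃, hk₃, hj₃, ht₃⟩ := ih s₂ a₂
        (fun j hj => by
          rw [a₁, ← Function.iterate_succ_apply]; exact h2 (j + 1) (by omega))
        (by rwa [a₁, ← Function.iterate_succ_apply])
        (fun j hj => by
          rw [a₁, ← Function.iterate_succ_apply]; exact h4 (j + 1) (by omega))
      refine ⟨s₃, _, .loop_true (by rw [h1]; exact h2 0 (by omega))
        (.seq e₁ (.seq (.assign _ _ _) e₂)) e₃, by rw [hk₃, a₁, ← Function.iterate_succ_apply],
        fun j hj => ?_, ?_⟩
      · rw [hj₃ j hj, hj₂ j (by omega), Function.update_of_ne (by omega), hj₁ j hj]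
      · have b₀ : (s k).size ≤ N := h4 0 (by omega)
        have b₁ : (step (s k)).size ≤ N := h4 1 (by omega)
        have := eval_mono_nat q b₀
        have := eval_mono_nat p b₁
        simp only [Function.update_self, hk₁] at ht₂
        simp only [Expr.eval, hk₁, Nat.succ_mul]
        omega
  refine ⟨.seq ci (.seq (.assign (k + 1) (.var k)) (.seq ct (.loop (k + 1) body))), fun s => ?_⟩
  obtain ⟨m, hm, h1, h2, h3, hFd⟩ := hF (s k)
  obtain ⟨s₀, t₀, e₀, hk₀, hj₀, ht₀⟩ := hci s
  obtain ⟨s₁, t₁, e₁, hk₁, hj₁, ht₁⟩ := hct (Function.update s₀ (k + 1) (s₀ k))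
  have a₁ : s₁ k = init (s k) := by
    rw [hj₁ k (by omega), Function.update_of_ne (by omega), hk₀]
  simp only [Function.update_self, hk₀] at hk₁ ht₁
  obtain ⟨s₂, t₂, e₂, hk₂, hj₂, ht₂⟩ := loop (b.eval (s k).size) m s₁ (by rw [hk₁, a₁])
    (by rwa [a₁]) (by rwa [a₁]) (by rwa [a₁])
  refine ⟨s₂, _, .seq e₀ (.seq (.assign _ _ _) (.seq e₁ e₂)), by rw [hk₂, a₁, hFd],
    fun j hj => ?_, ?_⟩
  · rw [hj₂ j hj, hj₁ j (by omega), Function.update_of_ne (by omega), hj₀ j hj]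
  · have := Nat.mul_le_mul_right (q.eval (b.eval (s k).size) + b.eval (s k).size +
      p.eval (b.eval (s k).size) + 2) hm
    have h4 : (init (s k)).size ≤ b.eval (s k).size := h3 0 (by omega)
    have := eval_mono_nat p h4
    simp only [Expr.eval, hk₀, Polynomial.eval_add, Polynomial.eval_mul, Polynomial.eval_comp,
      Polynomial.eval_ofNat]
    omega

end Computes

/-- Left fold over a list, with a context. -/
def Data.fold (g : Data → Data → Data → Data) (c : Data) : Data → Data → Data
  | .nil, a => a
  | .node x l, a => Data.fold g c l (g c x a)

/-- Every step of a fold adds only polynomially much to the accumulator. -/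
def SlowGrowth (g : Data → Data → Data → Data) : Prop :=
  ∃ q : Polynomial ℕ, ∀ c x a, (g c x a).size ≤ a.size + q.eval (c.size + x.size)

namespace Computes

variable {ι : Type} {O : ι → Set Data}

/-- The loop state consists of the context, the rest of the list and the accumulator. By
`SlowGrowth` each list entry contributes one polynomial summand, so the contributions add up instead
of being composed. -/
theorem fold {g : Data → Data → Data → Data} (hg : Computes O fun d => g d.hd d.tl.hd d.tl.tl)
    (hq : SlowGrowth g) {c l a : Data → Data} (hc : Computes O c) (hl : Computes O l)
    (ha : Computes O a) : Computes O fun d => Data.fold g (c d) (l d) (a d) := by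
  obtain ⟨q, hq⟩ := hq
  let step : Data → Data := fun d =>
    .node d.hd (.node d.tl.hd.tl (g d.hd d.tl.hd.hd d.tl.tl))
  have hstep : Computes O step :=
    id.hd.node (id.tl.hd.tl.node
      (hg.comp (f := fun d => .node d.hd (.node d.tl.hd.hd d.tl.tl))
        (id.hd.node (id.tl.hd.hd.node id.tl.tl))))
  have key : ∀ l c a : Data, ∃ m ≤ l.size, ∃ a',
      (∀ j < m, (step^[j] (.node c (.node l a))).tl.hd ≠ .nil) ∧
      step^[m] (.node c (.node l a)) = .node c (.node .nil a') ∧ a' = Data.fold g c l a ∧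
      ∀ j ≤ m, (step^[j] (.node c (.node l a))).size ≤
        c.size + l.size + a.size + 2 + j * q.eval (c.size + l.size) := by
    intro l
    induction l with
    | nil =>
      intro c a
      refine ⟨0, by simp, a, by simp, rfl, rfl, fun j hj => ?_⟩
      obtain rfl : j = 0 := by omega
      simp only [Function.iterate_zero_apply, Data.size]
      omega
    | node x l _ ih =>
      intro c a
      obtain ⟨m, hm, a', h1, h2, h3, h4⟩ := ih c (g c x a)
      have hs : step (.node c (.node (.node x l) a)) = .node c (.node l (g c x a)) := rfl
      refine ⟨m + 1, by simp only [Data.size]; omega, a', ?_, ?_, h3, ?_⟩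
      · rintro (_ | j) hj
        · simp [Data.tl, Data.hd]
        · rw [Function.iterate_succ_apply, hs]
          exact h1 j (by omega)
      · rw [Function.iterate_succ_apply, hs, h2]
      · rintro (_ | j) hj
        · simp only [Function.iterate_zero_apply, Data.size]
          omega
        · rw [Function.iterate_succ_apply, hs]
          have := h4 j (by omega)
          have h5 := hq c x a
          have h6 : q.eval (c.size + x.size) ≤ q.eval (c.size + (Data.node x l).size) :=
            eval_mono_nat q (by simp only [Data.size]; omega)
          have h7 : j * q.eval (c.size + l.size) ≤ j * q.eval (c.size + (Data.node x l).size) :=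
            Nat.mul_le_mul_left _ (eval_mono_nat q (by simp only [Data.size]; omega))
          have : c.size + l.size + (g c x a).size + 2 ≤ c.size + (Data.node x l).size + a.size + 2 +
            q.eval (c.size + x.size) := by simp only [Data.size]; omega
          rw [Nat.succ_mul]
          omega
  have hinit : Computes O fun d => .node (c d) (.node (l d) (a d)) := hc.node (hl.node ha)
  obtain ⟨p, hp, -⟩ := hinit
  have hF : Computes O fun d => .node (c d) (.node .nil (Data.fold g (c d) (l d) (a d))) := by
    -- The polynomial `p` bounds the initial state, hence both the number of rounds and the argument
    -- of `q` in each round.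
    refine Computes.loop (hc.node (hl.node ha)) (test := fun d => d.tl.hd) (step := step) Computes.id.tl.hd hstep
      (p + p * q.comp p) fun d => ?_
    obtain ⟨m, hm, a', h1, h2, h3, h4⟩ := key (l d) (c d) (a d)
    have hs := hp d
    simp only [Data.size] at hs
    simp only [Polynomial.eval_add, Polynomial.eval_mul, Polynomial.eval_comp]
    refine ⟨m, by omega, h1, by rw [h2]; rfl, fun j hj => (h4 j hj).trans ?_, by rw [h2, h3]⟩
    have h5 : j * q.eval ((c d).size + (l d).size) ≤ p.eval d.size * q.eval (p.eval d.size) :=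
      Nat.mul_le_mul (by omega) (eval_mono_nat q (by omega))
    omega
  exact hF.tl.tl

end Computes

/-! ## Constructions on interpretations -/

@[simp] theorem Role.inv_inv (r : Role) : r.inv.inv = r := by cases r <;> rfl

@[simp] theorem Role.name_inv (r : Role) : r.inv.name = r.name := by cases r <;> rfl

namespace Interp

@[simp] theorem role_inv (I : Interp) (r : Role) (d e : I.Dom) :
    I.role r.inv d e ↔ I.role r e d := by
  cases r <;> rfl

/-- The individual names are reassigned. -/
def withInd (I : Interp) (f : IndName → I.Dom) (hf : Function.Injective f) : Interp where
  Dom := I.Dom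
  con := I.con
  rol := I.rol
  ind := f
  ind_inj := hf

/-- A concept name is reinterpreted. -/
def setCon (I : Interp) (A : ConceptName) (P : Set I.Dom) : Interp where
  Dom := I.Dom
  con := Function.update I.con A P
  rol := I.rol
  ind := I.ind
  ind_inj := I.ind_inj

/-- The interpretation on `X` that is induced by `h`, with roles only between elements that are
related by `R`. -/
def pull (I : Interp) {X : Type} (h : X → I.Dom) (R : X → X → Prop) (f : IndName → X)
    (hf : Function.Injective f) : Interp where
  Dom := X
  con A := {x | h x ∈ I.con A}
  rol r x y := I.rol r (h x) (h y) ∧ R x y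
  ind := f
  ind_inj := hf

/-- Disjoint union. -/
def sum (I J : Interp) (f : IndName → I.Dom ⊕ J.Dom) (hf : Function.Injective f) : Interp where
  Dom := I.Dom ⊕ J.Dom
  con A := Sum.elim (I.con A) (J.con A)
  rol r x y := match x, y with
    | .inl d, .inl e => I.rol r d e
    | .inr d, .inr e => J.rol r d e
    | _, _ => False
  ind := f
  ind_inj := hf

theorem withInd_ext (I : Interp) {f : IndName → I.Dom} (hf : Function.Injective f) (C : Concept) :
    (I.withInd f hf).ext C = I.ext C := by
  have hr : ∀ r, (I.withInd f hf).role r = I.role r := fun r => by cases r <;> rfl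
  induction C with
  | and C D hC hD => simp only [ext, hC, hD]; rfl
  | ex r C hC => simp only [ext, hC, hr]; rfl
  | _ => rfl

theorem withInd_sat (I : Interp) {f : IndName → I.Dom} (hf : Function.Injective f) (α : Stmt) :
    (I.withInd f hf).Sat α ↔ I.Sat α := by
  have hr : ∀ r, (I.withInd f hf).role r = I.role r := fun r => by cases r <;> rfl
  cases α <;> simp only [Sat, withInd_ext, hr] <;> rfl

theorem setCon_ext (I : Interp) {A : ConceptName} (P : Set I.Dom) {S : Sig} (hA : A ∉ S.concepts)
    {C : Concept} (hC : C.Over S) : (I.setCon A P).ext C = I.ext C := by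
  have hr : ∀ r, (I.setCon A P).role r = I.role r := fun r => by cases r <;> rfl
  induction C with
  | and C D ihC ihD => simp only [ext, ihC hC.1, ihD hC.2]; rfl
  | ex r C ih => simp only [ext, ih hC.2, hr]; rfl
  | atom A' =>
    have : A' ≠ A := fun h => hA (h ▸ hC)
    simp [ext, setCon, this]
  | _ => rfl

theorem setCon_role (I : Interp) (A : ConceptName) (P : Set I.Dom) (r : Role) :
    (I.setCon A P).role r = I.role r := by cases r <;> rfl

theorem setCon_sat (I : Interp) {A : ConceptName} (P : Set I.Dom) {S : Sig} (hA : A ∉ S.concepts)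
    {α : Stmt} (hα : α.Over S) : (I.setCon A P).Sat α ↔ I.Sat α := by
  cases α with
  | ci C D => simp only [Sat, setCon_ext I P hA hα.1, setCon_ext I P hA hα.2]; rfl
  | ri r s => simp only [Sat, setCon_role]; rfl
  | func r => simp only [Sat, setCon_role]; rfl

/-! ### Pullbacks along covering maps -/

section Pull

variable {I : Interp} {X : Type} {h : X → I.Dom} {R : X → X → Prop} {f : IndName → X}
  {hf : Function.Injective f} {S : Sig}

theorem pull_role (hR : ∀ x y, R x y → R y x) (r : Role) (x y : X) :
    (I.pull h R f hf).role r x y ↔ I.role r (h x) (h y) ∧ R x y := by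
  cases r
  · rfl
  · exact and_congr_right fun _ => ⟨hR _ _, hR _ _⟩

/-- Since neighbours lift, `h` is a bisimulation; symmetry of `R` is needed because concepts also
look along inverse roles. -/
theorem pull_ext (hR : ∀ x y, R x y → R y x)
    (hlift : ∀ r : Role, r.Over S → ∀ x e, I.role r (h x) e → ∃ y, h y = e ∧ R x y)
    {C : Concept} (hC : C.Over S) (x : X) : x ∈ (I.pull h R f hf).ext C ↔ h x ∈ I.ext C := by
  induction C generalizing x with
  | and C D ihC ihD => exact and_congr (ihC hC.1 x) (ihD hC.2 x)
  | ex r C ih =>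
    constructor
    · rintro ⟨y, hxy, hy⟩
      exact ⟨h y, ((pull_role hR r x y).1 hxy).1, (ih hC.2 y).1 hy⟩
    · rintro ⟨e, hxe, he⟩
      obtain ⟨y, rfl, hy⟩ := hlift r hC.1 x e hxe
      exact ⟨y, (pull_role hR r x y).2 ⟨hxe, hy⟩, (ih hC.2 y).2 he⟩
  | _ => exact Iff.rfl

/-- Functionality needs more than bisimilarity: `huniq` says that an element has at most one
neighbour above a given one. Two-fold coverings and disjoint copies are the intended cases. -/
theorem pull_sat (hR : ∀ x y, R x y → R y x)
    (hlift : ∀ r : Role, r.Over S → ∀ x e, I.role r (h x) e → ∃ y, h y = e ∧ R x y)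
    (huniq : ∀ x y y', R x y → R x y' → h y = h y' → y = y')
    {α : Stmt} (hα : α.Over S) (hI : I.Sat α) : (I.pull h R f hf).Sat α := by
  cases α with
  | ci C D =>
    intro x hx
    exact (pull_ext hR hlift hα.2 x).2 (hI ((pull_ext hR hlift hα.1 x).1 hx))
  | ri r s =>
    intro x y hxy
    have hxy := (pull_role hR _ _ _).1 hxy
    exact (pull_role hR _ _ _).2 ⟨hI _ _ hxy.1, hxy.2⟩
  | func r =>
    intro x y y' h₁ h₂
    have h₁ := (pull_role hR _ _ _).1 h₁
    have h₂ := (pull_role hR _ _ _).1 h₂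
    exact huniq x y y' h₁.2 h₂.2 (hI _ _ _ h₁.1 h₂.1)

end Pull

/-! ### Disjoint unions -/

section Sum

variable {I J : Interp} {f : IndName → I.Dom ⊕ J.Dom} {hf : Function.Injective f}

theorem sum_role (r : Role) (x y : I.Dom ⊕ J.Dom) : (I.sum J f hf).role r x y ↔
    (∃ d e, x = .inl d ∧ y = .inl e ∧ I.role r d e) ∨
      ∃ d e, x = .inr d ∧ y = .inr e ∧ J.role r d e := by
  cases r <;> rcases x with x | x <;> rcases y with y | y <;> simp [role, sum]

theorem sum_ext (C : Concept) : (I.sum J f hf).ext C = Sum.elim (I.ext C) (J.ext C) := by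
  induction C with
  | top => ext (x | x) <;> exact Iff.rfl
  | bot => ext (x | x) <;> exact Iff.rfl
  | atom A => ext (x | x) <;> exact Iff.rfl
  | and C D hC hD =>
    simp only [ext, hC, hD]
    ext (x | x) <;> exact Iff.rfl
  | ex r C hC =>
    ext (x | x)
    · constructor
      · rintro ⟨y, h, hy⟩
        rw [hC] at hy
        rcases (sum_role _ _ _).1 h with ⟨d, e, hd, rfl, h⟩ | ⟨d, e, hd, rfl, h⟩ <;> cases hd
        exact ⟨e, h, hy⟩
      · rintro ⟨e, h, he⟩
        exact ⟨.inl e, (sum_role _ _ _).2 (.inl ⟨x, e, rfl, rfl, h⟩), by rwa [hC]⟩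
    · constructor
      · rintro ⟨y, h, hy⟩
        rw [hC] at hy
        rcases (sum_role _ _ _).1 h with ⟨d, e, hd, rfl, h⟩ | ⟨d, e, hd, rfl, h⟩ <;> cases hd
        exact ⟨e, h, hy⟩
      · rintro ⟨e, h, he⟩
        exact ⟨.inr e, (sum_role _ _ _).2 (.inr ⟨x, e, rfl, rfl, h⟩), by rwa [hC]⟩

theorem sum_sat {α : Stmt} (hI : I.Sat α) (hJ : J.Sat α) : (I.sum J f hf).Sat α := by
  cases α with
  | ci C D =>
    simp only [Sat, sum_ext]
    rintro (x | x) hx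
    · exact hI hx
    · exact hJ hx
  | ri r s =>
    intro x y h
    exact (sum_role _ _ _).2 <| ((sum_role _ _ _).1 h).imp (fun ⟨d, e, hd, he, h⟩ => ⟨d, e, hd, he, hI _ _ h⟩)
      fun ⟨d, e, hd, he, h⟩ => ⟨d, e, hd, he, hJ _ _ h⟩
  | func r =>
    intro x y y' h h'
    rcases (sum_role _ _ _).1 h with ⟨d, e, rfl, rfl, h₁⟩ | ⟨d, e, rfl, rfl, h₁⟩ <;>
      rcases (sum_role _ _ _).1 h' with ⟨d', e', hd, rfl, h₂⟩ | ⟨d', e', hd, rfl, h₂⟩ <;> cases hd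
    · rw [hI _ _ _ h₁ h₂]
    · rw [hJ _ _ _ h₁ h₂]

end Sum

end Interp

/-! ## Canonical models -/

/-- Some part of the concept is `⊥`. -/
def Concept.HasBot : Concept → Prop
  | .top => False
  | .bot => True
  | .atom _ => False
  | .and C D => C.HasBot ∨ D.HasBot
  | .ex _ C => C.HasBot

theorem Interp.ext_eq_empty (I : Interp) {C : Concept} (hC : C.HasBot) : I.ext C = ∅ := by
  induction C with
  | top => exact hC.elim
  | bot => rfl
  | atom A => exact hC.elim
  | and C D ihC ihD =>
    rcases hC with hC | hC
    · simp [ext, ihC hC]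
    · simp [ext, ihD hC]
  | ex r C ih => simp [ext, ih hC]

/-- The interpretation in which every element has exactly itself as a neighbour, and all concept
names but those in `P` are full. -/
def Interp.loops (P : Set ConceptName) : Interp where
  Dom := IndName
  con A := {_d | A ∉ P}
  rol _ d e := d = e
  ind d := d
  ind_inj := fun _ _ h => h

theorem Interp.loops_role (P : Set ConceptName) (r : Role) (d e : IndName) :
    (loops P).role r d e ↔ d = e := by
  cases r
  · rfl
  · exact eq_comm

theorem Interp.mem_loops_ext {P : Set ConceptName} {S : Sig} (hP : ∀ A ∈ P, A ∉ S.concepts)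
    {C : Concept} (hC : ¬ C.HasBot) (hS : C.Over S) (d : IndName) : d ∈ (loops P).ext C := by
  induction C generalizing d with
  | top => trivial
  | bot => exact hC trivial
  | atom A => exact fun h => hP A h hS
  | and C D ihC ihD =>
    exact ⟨ihC (fun h => hC (.inl h)) hS.1 d, ihD (fun h => hC (.inr h)) hS.2 d⟩
  | ex r C ih => exact ⟨d, (loops_role P r d d).2 rfl, ih hC hS.2 d⟩

namespace TBox

/-- The reflexive-transitive closure of the role inclusions. -/
def SubRole (T : TBox) : Role → Role → Prop :=
  Relation.ReflTransGen fun r s => Stmt.ri r s ∈ T.stmts ∨ Stmt.ri r.inv s.inv ∈ T.stmts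

variable {T : TBox}

theorem SubRole.inv {r s : Role} (h : T.SubRole r s) : T.SubRole r.inv s.inv := by
  refine Relation.ReflTransGen.lift Role.inv (fun a b hab => ?_) _ _ h
  simpa [Function.onFun] using hab.symm

theorem SubRole.role {r s : Role} (h : T.SubRole r s) {I : Interp} (hI : I.ModelOfTBox T)
    {d e : I.Dom} (hr : I.role r d e) : I.role s d e := by
  induction h with
  | refl => exact hr
  | tail _ h ih =>
    rcases h with h | h
    · exact hI _ h _ _ ih
    · simpa using hI _ h e d (by simpa using ih)

/-- The last inclusion of a nontrivial chain would give the functional role, or its inverse, a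
subrole. -/
theorem SubRole.eq_of_func {r s : Role} (h : T.SubRole s r) (hr : Stmt.func r ∈ T.stmts) :
    s = r := by
  rcases Relation.ReflTransGen.cases_tail h with h | ⟨u, -, h | h⟩
  · exact h.symm
  · exact absurd hr (T.no_subrole _ _ h).1
  · exact absurd hr (by simpa using (T.no_subrole _ _ h).2)

end TBox

/-- The elements of the canonical model: those of the given interpretation, and witnesses for
existential restrictions, arranged in trees. -/
inductive Node (X : Type) : Type
  | core (x : X) : Node X
  | child (w : Node X) (r : Role) (C : Concept) : Node X

section Canonical

variable (T : TBox) (S : Sig) (K : Interp)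

/-- The concepts that hold at an element of the canonical model. -/
def Node.type : Node K.Dom → Set Concept
  | .core x => {C | ∃ D : Concept, D.Over S ∧ x ∈ K.ext D ∧ T.Entails (.ci D C)}
  | .child w r C => {E | ∃ D ∈ w.type, T.Entails (.ci (.and C (.ex r.inv D)) E)}

/-- Roles in the canonical model. -/
inductive Node.Edge : Role → Node K.Dom → Node K.Dom → Prop
  | core {r s : Role} {x y : K.Dom} : s.Over S → K.role s x y → T.SubRole s r →
      Node.Edge r (.core x) (.core y)
  | down {r s : Role} {w : Node K.Dom} {C : Concept} : T.SubRole s r →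
      Node.Edge r w (.child w s C)
  | up {r s : Role} {w : Node K.Dom} {C : Concept} : T.SubRole s r.inv →
      Node.Edge r (.child w s C) w

/-- The node has an `r`-neighbour that is not one of its children. -/
def Node.HasNbr (r : Role) : Node K.Dom → Prop
  | .core x => r.Over S ∧ ∃ y, K.role r x y
  | .child _ s _ => s = r.inv

/-- A functional role must not get several witnesses. It therefore gets one child, labelled ⊤, and
only where neither the core nor the parent supplies a neighbour; the concepts required of this child
reach it through its type. -/
def Node.Valid : Node K.Dom → Prop
  | .core _ => True
  | .child w r C => w.Valid ∧ .ex r C ∈ w.type T S K ∧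
      (Stmt.func r ∈ T.stmts → C = .top ∧ ¬ w.HasNbr S K r)

/-- The canonical model. -/
def canonicalModel : Interp where
  Dom := {w : Node K.Dom // w.Valid T S K}
  con A := {w | .atom A ∈ w.1.type T S K}
  rol r w w' := Node.Edge T S K (.fwd r) w.1 w'.1
  ind a := ⟨.core (K.ind a), trivial⟩
  ind_inj := fun a b h => by
    have := congrArg Subtype.val h
    injection this with this
    exact K.ind_inj this

variable {T S K}

theorem Node.Edge.inv {r : Role} {w w' : Node K.Dom} (h : Node.Edge T S K r w w') :
    Node.Edge T S K r.inv w' w := by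
  cases h with
  | @core s _ _ h₁ h₂ h₃ =>
    exact Node.Edge.core (s := s.inv) (by simpa [Role.Over] using h₁) ((K.role_inv _ _ _).2 h₂)
      h₃.inv
  | down h => exact .up (by simpa using h)
  | up h => exact .down h

theorem canonicalModel_role (r : Role) (w w' : (canonicalModel T S K).Dom) :
    (canonicalModel T S K).role r w w' ↔ Node.Edge T S K r w.1 w'.1 := by
  cases r
  · rfl
  · exact ⟨fun h => Node.Edge.inv h, fun h => Node.Edge.inv h⟩

theorem Node.top_mem_type (w : Node K.Dom) (hw : w.Valid T S K) : .top ∈ w.type T S K := by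
  induction w with
  | core x => exact ⟨.top, trivial, trivial, fun _ _ => subset_rfl⟩
  | child w r C ih => exact ⟨.top, ih hw.1, fun _ _ _ _ => trivial⟩

theorem Node.type_closed {w : Node K.Dom} {C D : Concept} (hC : C ∈ w.type T S K)
    (h : T.Entails (.ci C D)) : D ∈ w.type T S K := by
  cases w with
  | core x =>
    obtain ⟨E, h₁, h₂, h₃⟩ := hC
    exact ⟨E, h₁, h₂, fun I hI => (h₃ I hI).trans (h I hI)⟩
  | child w r C' =>
    obtain ⟨E, h₁, h₂⟩ := hC
    exact ⟨E, h₁, fun I hI => (h₂ I hI).trans (h I hI)⟩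

theorem Node.and_mem_type {w : Node K.Dom} {C D : Concept} (hC : C ∈ w.type T S K)
    (hD : D ∈ w.type T S K) : .and C D ∈ w.type T S K := by
  induction w generalizing C D with
  | core x =>
    obtain ⟨E, h₁, h₂, h₃⟩ := hC
    obtain ⟨E', h₁', h₂', h₃'⟩ := hD
    exact ⟨.and E E', ⟨h₁, h₁'⟩, ⟨h₂, h₂'⟩, fun I hI d hd => ⟨h₃ I hI hd.1, h₃' I hI hd.2⟩⟩
  | child w r C' ih =>
    obtain ⟨E, h₁, h₂⟩ := hC
    obtain ⟨E', h₁', h₂'⟩ := hD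
    refine ⟨.and E E', ih h₁ h₁', fun I hI d hd => ?_⟩
    obtain ⟨hd, e, hde, he⟩ := hd
    exact ⟨h₂ I hI ⟨hd, e, hde, he.1⟩, h₂' I hI ⟨hd, e, hde, he.2⟩⟩

/-- A concept of a child gives an existential restriction of its parent. -/
theorem Node.ex_mem_type {w : Node K.Dom} {r : Role} {C E : Concept}
    (hC : .ex r C ∈ w.type T S K) (hE : E ∈ (Node.child w r C).type T S K) :
    .ex r E ∈ w.type T S K := by
  obtain ⟨D, hD, h⟩ := hE
  refine type_closed (and_mem_type hD hC) fun I hI d hd => ?_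
  obtain ⟨hd, e, hde, he⟩ := hd
  exact ⟨e, hde, h I hI ⟨he, d, (I.role_inv r e d).2 hde, hd⟩⟩

/-- A contradiction at a child gives ∃r.⊥, hence ⊥, at its parent, and so moves down to the core,
where `hcons` excludes it. -/
theorem Node.bot_notMem_type (hcons : ∀ D : Concept, D.Over S → T.Entails (.ci D .bot) →
    K.ext D = ∅) {w : Node K.Dom} (hw : w.Valid T S K) : .bot ∉ w.type T S K := by
  induction w with
  | core x =>
    rintro ⟨D, h₁, h₂, h₃⟩
    rw [hcons D h₁ h₃] at h₂
    exact h₂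
  | child w r C ih =>
    intro h
    refine ih hw.1 (type_closed (ex_mem_type hw.2.1 h) ?_)
    rintro I - d ⟨e, -, he⟩
    exact he

/-- The truth lemma. It rests on two transfers: a concept of a child becomes an existential
restriction of the parent, and a concept of the parent is visible to the child through the inverse
role. -/
theorem mem_canonicalModel_ext (hcons : ∀ D : Concept, D.Over S → T.Entails (.ci D .bot) →
    K.ext D = ∅) (C : Concept) (w : (canonicalModel T S K).Dom) :
    w ∈ (canonicalModel T S K).ext C ↔ C ∈ w.1.type T S K := by
  induction C generalizing w with
  | top => exact ⟨fun _ => w.1.top_mem_type w.2, fun _ => trivial⟩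
  | bot => exact ⟨fun h => h.elim, fun h => (Node.bot_notMem_type hcons w.2 h).elim⟩
  | atom A => rfl
  | and C D hC hD =>
    refine (and_congr (hC w) (hD w)).trans ⟨fun h => Node.and_mem_type h.1 h.2, fun h => ?_⟩
    exact ⟨Node.type_closed h fun I _ d hd => hd.1, Node.type_closed h fun I _ d hd => hd.2⟩
  | ex r C ih =>
    constructor
    · rintro ⟨⟨w', hw'⟩, hr, hC⟩
      have hC := (ih _).1 hC
      have hr := (canonicalModel_role _ _ _).1 hr
      obtain ⟨w, hw⟩ := w
      cases hr with
      | @core s x y hs hxy hsr =>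
        obtain ⟨D, h₁, h₂, h₃⟩ := hC
        refine ⟨.ex s D, ⟨hs, h₁⟩, ⟨y, hxy, h₂⟩, fun I hI d hd => ?_⟩
        obtain ⟨e, hde, he⟩ := hd
        exact ⟨e, hsr.role hI hde, h₃ I hI he⟩
      | @down s _ C' hsr =>
        refine Node.type_closed (Node.ex_mem_type hw'.2.1 hC) fun I hI d hd => ?_
        obtain ⟨e, hde, he⟩ := hd
        exact ⟨e, hsr.role hI hde, he⟩
      | @up s _ C' hsr =>
        refine ⟨C, hC, fun I hI d hd => ?_⟩
        obtain ⟨-, e, hde, he⟩ := hd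
        exact ⟨e, by simpa using hsr.inv.role hI hde, he⟩
    · intro hC
      obtain ⟨w, hw⟩ := w
      by_cases hr : Stmt.func r ∈ T.stmts
      -- With r functional, ∃r⁻.∃r.C implies C: any r-neighbour that is already present must satisfy
      -- C.
      · have hback : ∀ I : Interp, I.ModelOfTBox T → ∀ d ∈ I.ext (.ex r.inv (.ex r C)),
            d ∈ I.ext C := by
          rintro I hI d ⟨e, hde, e', hee', he'⟩
          rw [hI _ hr e d e' ((I.role_inv r d e).1 hde) hee']
          exact he'
        by_cases hn : w.HasNbr S K r
        · cases w with
          | core x =>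
            obtain ⟨hS, y, hxy⟩ := hn
            obtain ⟨D, h₁, h₂, h₃⟩ := hC
            refine ⟨⟨.core y, trivial⟩, (canonicalModel_role _ _ _).2 (.core hS hxy .refl),
              (ih _).2 ⟨.ex r.inv D, ⟨by simpa [Role.Over] using hS, h₁⟩,
                ⟨x, (K.role_inv _ _ _).2 hxy, h₂⟩, fun I hI d hd => hback I hI d ?_⟩⟩
            obtain ⟨e, hde, he⟩ := hd
            exact ⟨e, hde, h₃ I hI he⟩
          | child w s C' =>
            obtain rfl : s = r.inv := hn
            refine ⟨⟨w, hw.1⟩, (canonicalModel_role _ _ _).2 (.up .refl), (ih _).2 ?_⟩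
            exact Node.type_closed (Node.ex_mem_type hw.2.1 hC) fun I hI d hd => hback I hI d hd
        -- The new child is labelled only ⊤; it obtains C from ∃r⁻.∃r.C by `hback`.
        · have htop : .ex r .top ∈ w.type T S K :=
            Node.type_closed hC fun I hI d ⟨e, hde, _⟩ => ⟨e, hde, trivial⟩
          exact ⟨⟨.child w r .top, hw, htop, fun _ => ⟨rfl, hn⟩⟩,
            (canonicalModel_role _ _ _).2 (.down .refl),
            (ih _).2 ⟨.ex r C, hC, fun I hI d hd => hback I hI d hd.2⟩⟩
      · exact ⟨⟨.child w r C, hw, hC, fun h => absurd h hr⟩,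
          (canonicalModel_role _ _ _).2 (.down .refl),
          (ih _).2 ⟨.top, w.top_mem_type hw, fun I hI d hd => hd.1⟩⟩

/-- CIs hold because types are closed under consequences, RIs because edges are closed under
`SubRole`. For FAs, an edge of a functional role can only stem from that role itself, and validity
rules out a child beside another neighbour. -/
theorem canonicalModel_modelOfTBox
    (hfunc : ∀ r : Role, r.Over S → Stmt.func r ∈ T.stmts → K.Sat (.func r))
    (hcons : ∀ D : Concept, D.Over S → T.Entails (.ci D .bot) → K.ext D = ∅) :
    (canonicalModel T S K).ModelOfTBox T := by
  rintro (⟨C, D⟩ | ⟨r, s⟩ | r) hα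
  · intro w hw
    exact (mem_canonicalModel_ext hcons _ _).2 <|
      Node.type_closed ((mem_canonicalModel_ext hcons _ _).1 hw) fun I hI => hI _ hα
  · intro w w' h
    have h := (canonicalModel_role _ _ _).1 h
    refine (canonicalModel_role _ _ _).2 ?_
    generalize w.1 = v at h ⊢
    generalize w'.1 = v' at h ⊢
    cases h with
    | core h₁ h₂ h₃ => exact .core h₁ h₂ (h₃.tail (.inl hα))
    | down h => exact .down (h.tail (.inl hα))
    | up h => exact .up (h.tail (.inr (by simpa using hα)))
  · rintro ⟨w, hw⟩ ⟨w₁, hw₁⟩ ⟨w₂, hw₂⟩ h₁ h₂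
    have h₁ := (canonicalModel_role _ _ _).1 h₁
    have h₂ := (canonicalModel_role _ _ _).1 h₂
    refine Subtype.ext ?_
    -- Edges to the parent involve the inverse of a functional role, which has no proper subroles
    -- either.
    have hinv : ∀ {s}, T.SubRole s r.inv → s = r.inv := fun {s} h => by
      rw [← (show s.inv = r from TBox.SubRole.eq_of_func (by simpa using h.inv) hα), s.inv_inv]
    dsimp only at h₁ h₂ ⊢
    cases h₁ with
    | core hs hxy hsr =>
      obtain rfl := hsr.eq_of_func hα
      cases h₂ with
      | core hs' hxy' hsr' =>
        obtain rfl := hsr'.eq_of_func hα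
        rw [hfunc _ hs hα _ _ _ hxy hxy']
      | down hsr' =>
        obtain rfl := hsr'.eq_of_func hα
        exact absurd ⟨hs, _, hxy⟩ (hw₂.2.2 hα).2
    | down hsr =>
      obtain rfl := hsr.eq_of_func hα
      cases h₂ with
      | core hs' hxy' hsr' =>
        obtain rfl := hsr'.eq_of_func hα
        exact absurd ⟨hs', _, hxy'⟩ (hw₁.2.2 hα).2
      | down hsr' =>
        obtain rfl := hsr'.eq_of_func hα
        rw [(hw₁.2.2 hα).1, (hw₂.2.2 hα).1]
      | up hsr' => exact absurd (hinv hsr') (hw₁.2.2 hα).2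
    | up hsr =>
      cases h₂ with
      | down hsr' =>
        obtain rfl := hsr'.eq_of_func hα
        exact absurd (hinv hsr) (hw₂.2.2 hα).2
      | up hsr' => rfl

/-- Every interpretation without contradictions extends to a model of `T` in which only such
concepts hold that follow from the tree-shaped facts over `S`. -/
theorem exists_canonicalModel
    (hfunc : ∀ r : Role, r.Over S → Stmt.func r ∈ T.stmts → K.Sat (.func r))
    (hcons : ∀ D : Concept, D.Over S → T.Entails (.ci D .bot) → K.ext D = ∅) :
    ∃ (J : Interp) (f : K.Dom → J.Dom), J.ModelOfTBox T ∧ Function.Injective f ∧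
      (∀ a, J.ind a = f (K.ind a)) ∧
      (∀ A ∈ S.concepts, ∀ x ∈ K.con A, f x ∈ J.con A) ∧
      (∀ r ∈ S.roles, ∀ x y, K.rol r x y → J.rol r (f x) (f y)) ∧
      ∀ (C : Concept) (x : K.Dom), f x ∈ J.ext C →
        ∃ D : Concept, D.Over S ∧ x ∈ K.ext D ∧ T.Entails (.ci D C) := by
  refine ⟨canonicalModel T S K, fun x => ⟨.core x, trivial⟩,
    canonicalModel_modelOfTBox hfunc hcons, fun x y h => ?_, fun _ => rfl, fun A hA x hx => ?_,
    fun r hr x y hxy => ?_, fun C x hx => (mem_canonicalModel_ext hcons C _).1 hx⟩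
  · have := congrArg Subtype.val h
    injection this
  · exact ⟨.atom A, hA, hx, fun _ _ => subset_rfl⟩
  · exact .core (s := .fwd r) hr hxy .refl

end Canonical

/-! ## Trees -/

/-- Adding a pendant vertex to a tree gives a tree. -/
theorem isTree_of_pendant {V V' : Type*} {G : SimpleGraph V} {G' : SimpleGraph V'} (ι : V → V')
    (hι : Function.Injective ι) (y : V') (z : V) (hV : ∀ x, x = y ∨ ∃ v, x = ι v)
    (hy : ∀ v, ι v ≠ y) (hadj : ∀ a b, G'.Adj (ι a) (ι b) ↔ G.Adj a b)
    (hadj' : ∀ a, G'.Adj y (ι a) ↔ a = z) (hG : G.IsTree) : G'.IsTree := by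
  have hreach : ∀ x, G'.Reachable (ι z) x := by
    intro x
    rcases hV x with rfl | ⟨v, rfl⟩
    · exact ((hadj' z).2 rfl).symm.reachable
    · exact (hG.connected.preconnected z v).map ⟨ι, fun h => (hadj _ _).2 h⟩
  have : Nonempty V' := ⟨y⟩
  refine ⟨⟨fun a b => (hreach a).symm.trans (hreach b)⟩, ?_⟩
  -- Once its only edge is deleted the pendant vertex is isolated, so walks from it are trivial.
  have hleaf : ∀ a x, ¬ (G'.deleteEdges {s(y, ι a)}).Reachable y x ∨ x = y ∨ a ≠ z := by
    intro a x
    by_cases ha : a = z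
    · subst ha
      refine or_iff_not_imp_left.2 fun h => .inl ?_
      obtain ⟨w⟩ := not_not.1 h
      cases w with
      | nil => rfl
      | @cons _ b _ h _ =>
        exfalso
        rw [SimpleGraph.deleteEdges_adj] at h
        rcases hV b with rfl | ⟨b, rfl⟩
        · exact h.1.ne rfl
        · obtain rfl := (hadj' b).1 h.1
          exact h.2 rfl
    · exact .inr (.inr ha)
  have hpend : ∀ a, a = z → G'.IsBridge s(y, ι a) := by
    rintro a rfl
    rw [SimpleGraph.isBridge_iff]
    rcases hleaf a (ι a) with h | h | h
    · exact h
    · exact absurd h (hy a)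
    · exact absurd rfl h
  rw [SimpleGraph.isAcyclic_iff_forall_adj_isBridge]
  intro a b hab
  rcases hV a with rfl | ⟨a, rfl⟩
  · rcases hV b with rfl | ⟨b, rfl⟩
    · exact absurd rfl hab.ne
    · exact hpend b ((hadj' b).1 hab)
  · rcases hV b with rfl | ⟨b, rfl⟩
    · rw [Sym2.eq_swap]
      exact hpend a ((hadj' a).1 hab.symm)
    · have hb := SimpleGraph.isAcyclic_iff_forall_adj_isBridge.1 hG.isAcyclic ((hadj a b).1 hab)
      rw [SimpleGraph.isBridge_iff] at hb ⊢
      rintro ⟨w⟩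
      -- Collapsing `y` onto `z` turns a walk that avoids an old edge into a walk of the old graph
      -- that avoids it. So an old bridge remains a bridge.
      have key : ∀ (u v : V') (w : (G'.deleteEdges {s(ι a, ι b)}).Walk u v) (u' v' : V),
          (u = ι u' ∨ u = y ∧ u' = z) → (v = ι v' ∨ v = y ∧ v' = z) →
            (G.deleteEdges {s(a, b)}).Reachable u' v' := by
        intro u v w
        induction w with
        | nil =>
          rintro u' v' (h₁ | ⟨h₁, rfl⟩) (h₂ | ⟨h₂, rfl⟩)
          · rw [hι (h₁.symm.trans h₂)]
          · exact absurd (h₁.symm.trans h₂) (hy _)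
          · exact absurd (h₂.symm.trans h₁) (hy _)
          · exact .rfl
        | @cons u v _ h _ ih =>
          intro u' v' h₁ h₂
          rw [SimpleGraph.deleteEdges_adj] at h
          rcases hV v with rfl | ⟨v, rfl⟩
          · refine ih u' v' (.inr ⟨rfl, ?_⟩) h₂
            rcases h₁ with rfl | ⟨rfl, -⟩
            · exact (hadj' _).1 h.1.symm
            · exact absurd rfl h.1.ne
          · have := ih v v' (.inl rfl) h₂
            rcases h₁ with rfl | ⟨rfl, rfl⟩
            · refine SimpleGraph.Reachable.trans (SimpleGraph.Adj.reachable ?_) this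
              rw [SimpleGraph.deleteEdges_adj]
              refine ⟨(hadj _ _).1 h.1, fun he => h.2 ?_⟩
              have := congrArg (Sym2.map ι) (show s(u', v) = s(a, b) from he)
              simpa using this
            · rwa [← (hadj' v).1 h.1]
      exact hb (key _ _ w a b (.inl rfl) (.inl rfl))

/-! ### Parents in a rooted tree -/

section Parent

variable {V : Type*} {G : SimpleGraph V}

/-- Both neighbours extend to shortest paths from the root to `z`; paths in a tree are unique, hence
so is their penultimate vertex. -/
theorem parent_unique (hG : G.IsTree) {ρ z u u' : V} (hu : G.Adj u z) (hu' : G.Adj u' z)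
    (h : G.dist ρ z = G.dist ρ u + 1) (h' : G.dist ρ z = G.dist ρ u' + 1) : u = u' := by
  obtain ⟨p, hp⟩ := hG.connected.exists_walk_length_eq_dist ρ u
  obtain ⟨p', hp'⟩ := hG.connected.exists_walk_length_eq_dist ρ u'
  have h₁ := (p.concat hu).isPath_of_length_eq_dist (by rw [p.length_concat, hp, h])
  have h₂ := (p'.concat hu').isPath_of_length_eq_dist (by rw [p'.length_concat, hp', h'])
  have := congrArg SimpleGraph.Walk.penultimate ((hG.existsUnique_path ρ z).unique h₁ h₂)
  simpa using this

theorem exists_parent (hG : G.IsTree) {ρ z : V} {k : ℕ} (h : G.dist ρ z = k + 1) :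
    ∃ u, G.Adj u z ∧ G.dist ρ u = k := by
  obtain ⟨p, hp⟩ := hG.connected.exists_walk_length_eq_dist ρ z
  have hnil : ¬ p.Nil := fun hn => by
    have := SimpleGraph.Walk.length_eq_zero_iff.2 hn
    omega
  refine ⟨p.penultimate, p.adj_penultimate hnil, ?_⟩
  have h₁ : G.dist ρ p.penultimate ≤ p.dropLast.length := SimpleGraph.dist_le _
  rw [p.length_dropLast] at h₁
  rcases hG.dist_eq_dist_add_one_of_adj ρ (p.adj_penultimate hnil) with h₂ | h₂ <;> omega

end Parent

/-! ## Queries and concepts -/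

def OneTCQ.vars (q : OneTCQ) : Set Var := {z | z = q.ans ∨ z ∈ q.ex}

/-- All atoms of the query are satisfied. -/
def Interp.Match (I : Interp) (q : OneTCQ) (π : Var → I.Dom) : Prop :=
  ∀ α ∈ q.atoms, I.SatAtom π α

theorem Interp.satAtom_congr (I : Interp) {π π' : Var → I.Dom} {α : QAtom}
    (h : ∀ z ∈ α.vars, π z = π' z) : I.SatAtom π α ↔ I.SatAtom π' α := by
  cases α with
  | con A z => simp only [SatAtom, h z rfl]
  | rol r z z' => simp only [SatAtom, h z (.inl rfl), h z' (.inr rfl)]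

namespace OneTCQ

/-- The query without atoms. -/
def empty (x : Var) : OneTCQ where
  ans := x
  ex := []
  atoms := []
  ans_not_ex := by simp
  vars_sub := by simp
  no_loop := by simp
  tree := by
    have : Subsingleton {z : Var // z = x ∨ z ∈ ([] : List Var)} :=
      by
      refine ⟨fun a b => Subtype.ext ?_⟩
      have ha := a.2
      have hb := b.2
      simp only [List.not_mem_nil, or_false] at ha hb
      rw [ha, hb]
    have : Nonempty {z : Var // z = x ∨ z ∈ ([] : List Var)} := ⟨⟨x, .inl rfl⟩⟩
    exact SimpleGraph.IsTree.of_subsingleton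
  no_multi_edge := by simp

/-- A concept atom is added. -/
def addCon (q : OneTCQ) (A : ConceptName) (z : Var) (hz : z ∈ q.vars) : OneTCQ where
  ans := q.ans
  ex := q.ex
  atoms := .con A z :: q.atoms
  ans_not_ex := q.ans_not_ex
  vars_sub := by
    rintro α hα u hu
    rcases List.mem_cons.1 hα with rfl | hα
    · obtain rfl : u = z := hu
      exact hz
    · exact q.vars_sub α hα u hu
  no_loop := by simpa using q.no_loop
  tree := by simpa using q.tree
  no_multi_edge := by simpa using q.no_multi_edge

/-- The role atom for a role. -/
def roleAtom : Role → Var → Var → QAtom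
  | .fwd r, z, y => .rol r z y
  | .bwd r, z, y => .rol r y z

theorem roleAtom_vars (r : Role) (z y : Var) : (roleAtom r z y).vars = {z, y} := by
  cases r
  · rfl
  · exact Set.pair_comm _ _

theorem satAtom_roleAtom {I : Interp} {π : Var → I.Dom} (r : Role) (z y : Var) :
    I.SatAtom π (roleAtom r z y) ↔ I.role r (π z) (π y) := by
  cases r <;> rfl

/-- A pendant vertex is added. -/
def addRole (q : OneTCQ) (r : Role) (z y : Var) (hz : z ∈ q.vars) (hy : y ∉ q.vars) : OneTCQ where
  ans := q.ans
  ex := y :: q.ex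
  atoms := roleAtom r z y :: q.atoms
  ans_not_ex := by
    simp only [List.mem_cons, not_or]
    exact ⟨fun h => hy (.inl h.symm), q.ans_not_ex⟩
  vars_sub := by
    intro α hα u hu
    rcases List.mem_cons.1 hα with rfl | hα
    · rw [roleAtom_vars] at hu
      rcases hu with rfl | rfl
      · exact hz.imp_right (List.mem_cons_of_mem _)
      · exact .inr List.mem_cons_self
    · exact (q.vars_sub α hα u hu).imp_right (List.mem_cons_of_mem _)
  no_loop := by
    intro s u h
    rcases List.mem_cons.1 h with h | h
    · have hzy : z ≠ y := fun h => hy (h ▸ hz)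
      cases r <;> simp only [roleAtom, QAtom.rol.injEq] at h
      · exact hzy (h.2.1.symm.trans h.2.2)
      · exact hzy (h.2.2.symm.trans h.2.1)
    · exact q.no_loop s u h
  tree := by
    have hnot : ∀ {s u v}, .rol s u v ∈ q.atoms → u ≠ y ∧ v ≠ y := fun h =>
      ⟨fun e => hy (e ▸ q.vars_sub _ h _ (.inl rfl)), fun e => hy (e ▸ q.vars_sub _ h _ (.inr rfl))⟩
    have hne : ∀ v : {u : Var // u = q.ans ∨ u ∈ q.ex}, v.1 ≠ y := fun v e => hy (e ▸ v.2)
    refine isTree_of_pendant (G := SimpleGraph.fromRel _)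
      (fun v : {u : Var // u = q.ans ∨ u ∈ q.ex} => ⟨v.1, v.2.imp_right (List.mem_cons_of_mem _)⟩)
      (fun a b h => Subtype.ext (Subtype.mk.inj h)) ⟨y, .inr List.mem_cons_self⟩ ⟨z, hz⟩
      ?_ ?_ ?_ ?_ q.tree
    · rintro ⟨x, hx | hx⟩
      · exact .inr ⟨⟨x, .inl hx⟩, rfl⟩
      · rcases List.mem_cons.1 hx with rfl | hx'
        · exact .inl rfl
        · exact .inr ⟨⟨x, .inr hx'⟩, rfl⟩
    · intro v h
      exact hne v (congrArg Subtype.val h)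
    · intro a b
      have ha := hne a
      have hb := hne b
      simp only [SimpleGraph.fromRel_adj, ne_eq, Subtype.mk.injEq, List.mem_cons]
      cases r <;> simp [roleAtom, ha, hb, Subtype.ext_iff]
    · intro a
      have ha := hne a
      simp only [SimpleGraph.fromRel_adj, ne_eq, List.mem_cons, Subtype.ext_iff]
      have h₁ : ∀ s, .rol s y a.1 ∉ q.atoms := fun s h => (hnot h).1 rfl
      have h₂ : ∀ s, .rol s a.1 y ∉ q.atoms := fun s h => (hnot h).2 rfl
      have hzy : z ≠ y := fun h => hy (h ▸ hz)
      cases r <;> simp [roleAtom, ha, Ne.symm ha, h₁, h₂, hzy.symm]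
  no_multi_edge := by
    have hnot : ∀ {s u v}, .rol s u v ∈ q.atoms → u ≠ y ∧ v ≠ y := fun h =>
      ⟨fun e => hy (e ▸ q.vars_sub _ h _ (.inl rfl)), fun e => hy (e ▸ q.vars_sub _ h _ (.inr rfl))⟩
    intro s t a b c d h₁ h₂ he
    rcases List.mem_cons.1 h₁ with h₁ | h₁ <;> rcases List.mem_cons.1 h₂ with h₂ | h₂
    · rw [h₁, h₂]
    · have := hnot h₂
      cases r <;> simp only [roleAtom, QAtom.rol.injEq] at h₁ <;> obtain ⟨rfl, rfl, rfl⟩ := h₁ <;>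
        rcases Sym2.eq_iff.1 he with ⟨rfl, rfl⟩ | ⟨rfl, rfl⟩ <;> simp at this
    · have := hnot h₁
      cases r <;> simp only [roleAtom, QAtom.rol.injEq] at h₂ <;> obtain ⟨rfl, rfl, rfl⟩ := h₂ <;>
        rcases Sym2.eq_iff.1 he with ⟨rfl, rfl⟩ | ⟨rfl, rfl⟩ <;> simp at this
    · exact q.no_multi_edge s t a b c d h₁ h₂ he

theorem exists_notMem_vars (q : OneTCQ) : ∃ y, y ∉ q.vars := by
  have : q.vars.Finite := (Set.finite_singleton q.ans).union (List.finite_toSet q.ex)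
  exact this.exists_notMem

/-- A concept is imposed on a variable of a query. -/
theorem exists_addConcept {S : Sig} {D : Concept} (hD : ¬ D.HasBot) (hS : D.Over S) :
    ∀ (q : OneTCQ) (z : Var), q.Over S → z ∈ q.vars → ∃ q' : OneTCQ, q'.ans = q.ans ∧ q'.Over S ∧
      q.vars ⊆ q'.vars ∧ ∀ (I : Interp) (π : Var → I.Dom),
        (I.Match q' π → I.Match q π ∧ π z ∈ I.ext D) ∧
        (I.Match q π → π z ∈ I.ext D → ∃ π', (∀ u ∈ q.vars, π' u = π u) ∧ I.Match q' π') := by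
  induction D with
  | top =>
    exact fun q z hq hz => ⟨q, rfl, hq, subset_rfl, fun I π => ⟨fun h => ⟨h, trivial⟩,
      fun h _ => ⟨π, fun _ _ => rfl, h⟩⟩⟩
  | bot => exact absurd trivial hD
  | atom A =>
    intro q z hq hz
    refine ⟨q.addCon A z hz, rfl, ?_, subset_rfl, fun I π => ?_⟩
    · intro α hα
      rcases List.mem_cons.1 hα with rfl | hα
      · exact hS
      · exact hq α hα
    · refine ⟨fun h => ?_, fun h hz => ⟨π, fun _ _ => rfl, ?_⟩⟩
      · exact ⟨fun α hα => h α (List.mem_cons_of_mem _ hα), h _ List.mem_cons_self⟩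
      · intro α hα
        rcases List.mem_cons.1 hα with rfl | hα
        · exact hz
        · exact h α hα
  | and C D ihC ihD =>
    intro q z hq hz
    obtain ⟨q₁, ha₁, hS₁, hv₁, h₁⟩ := ihC (fun h => hD (.inl h)) hS.1 q z hq hz
    obtain ⟨q₂, ha₂, hS₂, hv₂, h₂⟩ := ihD (fun h => hD (.inr h)) hS.2 q₁ z hS₁ (hv₁ hz)
    refine ⟨q₂, ha₂.trans ha₁, hS₂, hv₁.trans hv₂, fun I π => ⟨fun h => ?_, fun h hπ => ?_⟩⟩
    · have h' := (h₂ I π).1 h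
      have h'' := (h₁ I π).1 h'.1
      exact ⟨h''.1, h''.2, h'.2⟩
    · obtain ⟨π₁, e₁, m₁⟩ := (h₁ I π).2 h hπ.1
      obtain ⟨π₂, e₂, m₂⟩ := (h₂ I π₁).2 m₁ (by rw [e₁ z hz]; exact hπ.2)
      exact ⟨π₂, fun u hu => by rw [e₂ u (hv₁ hu), e₁ u hu], m₂⟩
  | ex r C ih =>
    intro q z hq hz
    obtain ⟨y, hy⟩ := q.exists_notMem_vars
    have hv : q.vars ⊆ (q.addRole r z y hz hy).vars := fun u hu =>
      hu.imp_right (List.mem_cons_of_mem _)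
    obtain ⟨q', ha, hS', hv', h'⟩ := ih hD hS.2 (q.addRole r z y hz hy) y (by
      intro α hα
      rcases List.mem_cons.1 hα with rfl | hα
      · have := hS.1
        cases r <;> exact this
      · exact hq α hα) (.inr List.mem_cons_self)
    refine ⟨q', ha, hS', hv.trans hv', fun I π => ⟨fun h => ?_, fun h hπ => ?_⟩⟩
    · have h₁ := (h' I π).1 h
      exact ⟨fun α hα => h₁.1 α (List.mem_cons_of_mem _ hα), π y,
        (satAtom_roleAtom r z y).1 (h₁.1 _ List.mem_cons_self), h₁.2⟩
    · obtain ⟨e, hze, he⟩ := hπ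
      have hkeep : ∀ u ∈ q.vars, Function.update π y e u = π u := fun u hu =>
        Function.update_of_ne (fun h : u = y => hy (h ▸ hu)) _ _
      obtain ⟨π', e', m'⟩ := (h' I (Function.update π y e)).2 (by
        intro α hα
        rcases List.mem_cons.1 hα with rfl | hα
        · rw [satAtom_roleAtom, hkeep z hz, Function.update_self]
          exact hze
        · exact (I.satAtom_congr fun u hu => hkeep u (q.vars_sub α hα u hu)).2 (h α hα))
        (by rwa [Function.update_self])
      exact ⟨π', fun u hu => by rw [e' u (hv hu), hkeep u hu], m'⟩

end OneTCQ

/-- Every concept without `⊥` is expressed by a query. -/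
theorem exists_query_of_concept {S : Sig} {D : Concept} (hD : ¬ D.HasBot) (hS : D.Over S) :
    ∃ q : OneTCQ, q.Over S ∧ ∀ (I : Interp) (d : I.Dom),
      (∃ π, π q.ans = d ∧ I.Match q π) ↔ d ∈ I.ext D := by
  obtain ⟨q, ha, hS', -, h⟩ := OneTCQ.exists_addConcept hD hS (.empty []) []
    (fun α hα => by cases hα) (.inl rfl)
  change q.ans = [] at ha
  refine ⟨q, hS', fun I d => ⟨?_, fun hd => ?_⟩⟩
  · rintro ⟨π, rfl, hm⟩
    rw [ha]
    exact ((h I π).1 hm).2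
  · obtain ⟨π, h₁, h₂⟩ := (h I fun _ => d).2 (fun α hα => by cases hα) hd
    exact ⟨π, by rw [ha, h₁ [] (.inl rfl)], h₂⟩

/-- The conjunction of a list of concepts. -/
def Concept.conj : List Concept → Concept
  | [] => .top
  | C :: l => .and C (conj l)

theorem Interp.mem_ext_conj {I : Interp} {l : List Concept} {d : I.Dom} :
    d ∈ I.ext (Concept.conj l) ↔ ∀ C ∈ l, d ∈ I.ext C := by
  induction l with
  | nil => simp [Concept.conj, ext]
  | cons C l ih => simp [Concept.conj, ext, ih]

theorem Concept.conj_over {S : Sig} {l : List Concept} (h : ∀ C ∈ l, C.Over S) :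
    (conj l).Over S := by
  induction l with
  | nil => trivial
  | cons C l ih => exact ⟨h C List.mem_cons_self, ih fun D hD => h D (List.mem_cons_of_mem _ hD)⟩

theorem Concept.conj_hasBot {l : List Concept} (h : ∀ C ∈ l, ¬ C.HasBot) : ¬ (conj l).HasBot := by
  induction l with
  | nil => exact fun h => h
  | cons C l ih =>
    rintro (h' | h')
    · exact h C List.mem_cons_self h'
    · exact ih (fun D hD => h D (List.mem_cons_of_mem _ hD)) h'

open Classical in
/-- What an atom says about the variable `z`, if `f` describes the neighbours of `z`. -/
noncomputable def QAtom.describe (f : Var → Concept) (z : Var) : QAtom → Concept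
  | .con A u => if u = z then .atom A else .top
  | .rol r u v => .and (if u = z then .ex (.fwd r) (f v) else .top)
      (if v = z then .ex (.bwd r) (f u) else .top)

namespace OneTCQ

/-- The unfolding of the query at a variable, up to a given depth. -/
noncomputable def unfold (q : OneTCQ) : ℕ → Var → Concept
  | 0 => fun _ => .top
  | n + 1 => fun z => .conj (q.atoms.map (QAtom.describe (q.unfold n) z))

variable {q : OneTCQ}

theorem unfold_over {S : Sig} (hq : q.Over S) (n : ℕ) (z : Var) : (q.unfold n z).Over S := by
  induction n generalizing z with
  | zero => trivial
  | succ n ih =>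
    refine Concept.conj_over fun C hC => ?_
    obtain ⟨α, hα, rfl⟩ := List.mem_map.1 hC
    have := hq α hα
    cases α with
    | con A u =>
      simp only [QAtom.describe]
      split
      · exact this
      · trivial
    | rol r u v =>
      simp only [QAtom.describe]
      constructor <;> split
      · exact ⟨this, ih v⟩
      · trivial
      · exact ⟨this, ih u⟩
      · trivial

theorem unfold_hasBot (n : ℕ) (z : Var) : ¬ (q.unfold n z).HasBot := by
  induction n generalizing z with
  | zero => exact fun h => h
  | succ n ih =>
    refine Concept.conj_hasBot fun C hC => ?_
    obtain ⟨α, -, rfl⟩ := List.mem_map.1 hC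
    cases α with
    | con A u =>
      simp only [QAtom.describe]
      split <;> exact fun h => h
    | rol r u v =>
      simp only [QAtom.describe]
      rintro (h | h) <;> split at h
      · exact ih v h
      · exact h
      · exact ih u h
      · exact h

theorem mem_ext_unfold_succ {I : Interp} {n : ℕ} {z : Var} {d : I.Dom} :
    d ∈ I.ext (q.unfold (n + 1) z) ↔
      (∀ A, .con A z ∈ q.atoms → d ∈ I.con A) ∧
      ∀ r y, roleAtom r z y ∈ q.atoms → ∃ e, I.role r d e ∧ e ∈ I.ext (q.unfold n y) := by
  rw [unfold, Interp.mem_ext_conj]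
  constructor
  · intro h
    refine ⟨fun A hA => ?_, fun r y hr => ?_⟩
    · simpa [QAtom.describe, Interp.ext] using h _ (List.mem_map.2 ⟨_, hA, rfl⟩)
    · have := h _ (List.mem_map.2 ⟨_, hr, rfl⟩)
      cases r
      · have := this.1
        rwa [if_pos rfl] at this
      · have := this.2
        rwa [if_pos rfl] at this
  · rintro ⟨h₁, h₂⟩ C hC
    obtain ⟨α, hα, rfl⟩ := List.mem_map.1 hC
    cases α with
    | con A u =>
      simp only [QAtom.describe]
      split
      · subst u
        exact h₁ A hα
      · trivial
    | rol r u v =>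
      simp only [QAtom.describe]
      constructor <;> split
      · subst u
        exact h₂ (.fwd r) v hα
      · trivial
      · subst v
        exact h₂ (.bwd r) u hα
      · trivial

/-- The unfolding may run back along an edge that it has just used, but a match provides witnesses
for every walk in the query, so all depths hold. -/
theorem mem_ext_unfold_of_match {I : Interp} {π : Var → I.Dom} (hπ : I.Match q π) (n : ℕ)
    (z : Var) : π z ∈ I.ext (q.unfold n z) := by
  induction n generalizing z with
  | zero => trivial
  | succ n ih =>
    exact mem_ext_unfold_succ.2 ⟨fun A hA => hπ _ hA, fun r y hr =>
      ⟨π y, (satAtom_roleAtom r z y).1 (hπ _ hr), ih y⟩⟩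

/-- The graph of the query. -/
def graph (q : OneTCQ) : SimpleGraph {z : Var // z = q.ans ∨ z ∈ q.ex} :=
  SimpleGraph.fromRel fun u v => ∃ r, QAtom.rol r u v ∈ q.atoms

def root (q : OneTCQ) : {z : Var // z = q.ans ∨ z ∈ q.ex} := ⟨q.ans, .inl rfl⟩

theorem graph_adj_iff {u v : {z : Var // z = q.ans ∨ z ∈ q.ex}} :
    q.graph.Adj u v ↔ ∃ r, roleAtom r u.1 v.1 ∈ q.atoms := by
  rw [graph, SimpleGraph.fromRel_adj]
  constructor
  · rintro ⟨-, ⟨r, hr⟩ | ⟨r, hr⟩⟩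
    · exact ⟨.fwd r, hr⟩
    · exact ⟨.bwd r, hr⟩
  · rintro ⟨r | r, hr⟩
    · exact ⟨fun h => q.no_loop r v.1 (h ▸ hr), .inl ⟨r, hr⟩⟩
    · exact ⟨fun h => q.no_loop r v.1 (h ▸ hr), .inr ⟨r, hr⟩⟩

/-- Consequently a witness chosen for one role atom on an edge serves for the whole edge. -/
theorem roleAtom_unique {r s : Role} {u v : Var} (hr : roleAtom r u v ∈ q.atoms)
    (hs : roleAtom s u v ∈ q.atoms) : r = s := by
  have hne : ∀ {t : RoleName}, .rol t u v ∈ q.atoms → u ≠ v := fun h e => q.no_loop _ _ (e ▸ h)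
  have hne' : ∀ {t : RoleName}, .rol t v u ∈ q.atoms → u ≠ v := fun h e => q.no_loop _ _ (e ▸ h)
  cases r <;> cases s <;> simp only [roleAtom] at hr hs
  · have := q.no_multi_edge _ _ _ _ _ _ hr hs rfl
    simp_all
  · have := q.no_multi_edge _ _ _ _ _ _ hr hs Sym2.eq_swap
    simp only [QAtom.rol.injEq] at this
    exact absurd this.2.1 (hne hr)
  · have := q.no_multi_edge _ _ _ _ _ _ hr hs Sym2.eq_swap
    simp only [QAtom.rol.injEq] at this
    exact absurd this.2.2 (hne hs)
  · have := q.no_multi_edge _ _ _ _ _ _ hr hs rfl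
    simp_all

/-- The match is built level by level from the root. A vertex at distance k still satisfies the
unfolding to depth N − k, which yields witnesses for its children. -/
theorem exists_match_of_unfold {I : Interp} {N : ℕ} (hN : ∀ z, q.graph.dist q.root z < N)
    {d : I.Dom} (hd : d ∈ I.ext (q.unfold N q.ans)) :
    ∃ π : Var → I.Dom, π q.ans = d ∧ I.Match q π := by
  have htree : q.graph.IsTree := q.tree
  have hroot : ∀ z, q.graph.dist q.root z = 0 ↔ z = q.root := fun z => by
    rw [htree.connected.dist_eq_zero_iff, eq_comm]
  have step : ∀ k, ∃ π : {z : Var // z = q.ans ∨ z ∈ q.ex} → I.Dom, π q.root = d ∧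
      (∀ z, q.graph.dist q.root z ≤ k →
        π z ∈ I.ext (q.unfold (N - q.graph.dist q.root z) z.1)) ∧
      ∀ u v r, q.graph.dist q.root v = q.graph.dist q.root u + 1 → q.graph.dist q.root v ≤ k →
        roleAtom r u.1 v.1 ∈ q.atoms → I.role r (π u) (π v) := by
    intro k
    induction k with
    | zero =>
      refine ⟨fun _ => d, rfl, fun z hz => ?_, fun u v r h₁ h₂ => by omega⟩
      obtain rfl := (hroot z).1 (by omega)
      rw [(hroot _).2 rfl]
      exact hd
    | succ k ih =>
      obtain ⟨π, h₀, h₁, h₂⟩ := ih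
      have hex : ∀ z, ∃ e, q.graph.dist q.root z = k + 1 →
          e ∈ I.ext (q.unfold (N - (k + 1)) z.1) ∧
          ∀ u r, q.graph.dist q.root u = k → roleAtom r u.1 z.1 ∈ q.atoms → I.role r (π u) e := by
        intro z
        by_cases hz : q.graph.dist q.root z = k + 1
        · obtain ⟨u, hu, hk⟩ := exists_parent htree hz
          obtain ⟨r, hr⟩ := graph_adj_iff.1 hu
          have := h₁ u hk.le
          have hNz := hN z
          rw [hk, show N - k = N - (k + 1) + 1 by omega, mem_ext_unfold_succ] at this
          obtain ⟨e, he, he'⟩ := this.2 r z.1 hr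
          refine ⟨e, fun _ => ⟨he', fun u' r' hu' hr' => ?_⟩⟩
          -- Parent and role are unique, so only one constraint from the previous level concerns the
          -- new value.
          obtain rfl := parent_unique htree hu (graph_adj_iff.2 ⟨r', hr'⟩)
            (by rw [hz, hk]) (by rw [hz, hu'])
          rwa [← roleAtom_unique hr hr']
        · exact ⟨d, fun h => absurd h hz⟩
      choose e he using hex
      classical
      refine ⟨fun z => if q.graph.dist q.root z = k + 1 then e z else π z, ?_, ?_, ?_⟩
      · exact (if_neg (by rw [(hroot _).2 rfl]; omega)).trans h₀
      · intro z hz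
        dsimp only
        split
        · next h => rw [h]; exact (he z h).1
        · exact h₁ z (by omega)
      · intro u v r huv hv hr
        dsimp only
        rw [if_neg (show ¬ q.graph.dist q.root u = k + 1 by omega)]
        split
        · next h => exact (he v h).2 u r (by omega) hr
        · exact h₂ u v r huv (by omega) hr
  obtain ⟨π, h₀, h₁, h₂⟩ := step N
  classical
  refine ⟨fun z => if h : z = q.ans ∨ z ∈ q.ex then π ⟨z, h⟩ else d, ?_, fun α hα => ?_⟩
  · exact (dif_pos (.inl rfl)).trans h₀
  · cases α with
    | con A z =>
      have hz := q.vars_sub _ hα z rfl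
      have := h₁ ⟨z, hz⟩ (hN _).le
      have hNz := hN ⟨z, hz⟩
      -- Since distances are strictly below N, at least one level of unfolding is left, and it
      -- contains the concept atoms of the variable.
      rw [show N - q.graph.dist q.root ⟨z, hz⟩ = N - q.graph.dist q.root ⟨z, hz⟩ - 1 + 1 by omega,
        mem_ext_unfold_succ] at this
      simpa only [Interp.SatAtom, dif_pos hz] using this.1 A hα
    | rol r u v =>
      have hu := q.vars_sub _ hα u (.inl rfl)
      have hv := q.vars_sub _ hα v (.inr rfl)
      simp only [Interp.SatAtom, dif_pos hu, dif_pos hv]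
      have hadj : q.graph.Adj ⟨u, hu⟩ ⟨v, hv⟩ := graph_adj_iff.2 ⟨.fwd r, hα⟩
      rcases htree.dist_eq_dist_add_one_of_adj q.root hadj with h | h
      · exact h₂ _ _ (.bwd r) h (hN _).le hα
      · exact h₂ _ _ (.fwd r) h (hN _).le hα

end OneTCQ

/-- Every query is expressed by a concept. -/
theorem exists_concept_of_query {S : Sig} {q : OneTCQ} (hq : q.Over S) :
    ∃ C : Concept, C.Over S ∧ ¬ C.HasBot ∧
      ∀ (I : Interp) (a : IndName), I.SatQuery q a ↔ I.ind a ∈ I.ext C := by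
  have hfin : Finite {z : Var // z = q.ans ∨ z ∈ q.ex} :=
    ((Set.finite_singleton q.ans).union (List.finite_toSet q.ex)).to_subtype
  obtain ⟨N, hN⟩ := (Set.finite_range (q.graph.dist q.root)).bddAbove
  refine ⟨q.unfold (N + 1) q.ans, OneTCQ.unfold_over hq _ _, OneTCQ.unfold_hasBot _ _,
    fun I a => ⟨?_, fun h => ?_⟩⟩
  · rintro ⟨π, hπ, hm⟩
    rw [← hπ]
    exact OneTCQ.mem_ext_unfold_of_match hm _ _
  · exact OneTCQ.exists_match_of_unfold
      (fun z => Nat.lt_succ_of_le (hN (Set.mem_range_self z))) h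

/-! ## Naming elements -/

/-- Composing with a transposition keeps the names distinct. Names assigned earlier are not
disturbed, so several can be prescribed in turn. -/
theorem exists_ind_eq {X : Type} {f : IndName → X} (hf : Function.Injective f) (a : IndName)
    (d : X) : ∃ f' : IndName → X, Function.Injective f' ∧ f' a = d ∧
      ∀ b, b ≠ a → f b ≠ d → f' b = f b := by
  classical
  refine ⟨fun b => Equiv.swap (f a) d (f b), (Equiv.injective _).comp hf,
    Equiv.swap_apply_left _ _, fun b hb hd => ?_⟩
  exact Equiv.swap_apply_of_ne_of_ne (hf.ne hb) hd

theorem exists_ind_range {X : Type} {f : IndName → X} (hf : Function.Injective f) {F : Set X}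
    (hF : F.Finite) : ∃ g : IndName → X, Function.Injective g ∧ F ⊆ Set.range g := by
  induction F, hF using Set.Finite.induction_on with
  | empty => exact ⟨f, hf, Set.empty_subset _⟩
  | @insert d F _ hF ih =>
    obtain ⟨g, hg, hr⟩ := ih
    by_cases hd : d ∈ Set.range g
    · exact ⟨g, hg, Set.insert_subset hd hr⟩
    -- The name given to `d` is one that does not denote an element of `F`, so nothing in `F` loses
    -- its name.
    · obtain ⟨a, ha⟩ := (hF.preimage hg.injOn : (g ⁻¹' F).Finite).exists_notMem
      obtain ⟨g', hg', h₁, h₂⟩ := exists_ind_eq hg a d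
      refine ⟨g', hg', Set.insert_subset ⟨a, h₁⟩ fun e he => ?_⟩
      obtain ⟨b, rfl⟩ := hr he
      exact ⟨b, h₂ b (fun h => ha (h ▸ he)) fun h => hd ⟨b, h⟩⟩

/-! ## Role inclusions and functionality assertions as queries -/

/-- The role assertion for a role. -/
def roleAssertion : Role → IndName → IndName → Assertion
  | .fwd r, a, b => .rol r a b
  | .bwd r, a, b => .rol r b a

theorem Interp.satAssertion_roleAssertion {I : Interp} (r : Role) (a b : IndName) :
    I.SatAssertion (roleAssertion r a b) ↔ I.role r (I.ind a) (I.ind b) := by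
  cases r <;> rfl

/-- The query `B(x)`. -/
def conQuery (B : ConceptName) : OneTCQ := (OneTCQ.empty []).addCon B [] (.inl rfl)

/-- The query `∃ y, r(x, y) ∧ B(y)`. -/
def roleQuery (r : Role) (B : ConceptName) : OneTCQ :=
  ((OneTCQ.empty []).addRole r [] [false] (.inl rfl) (by simp [OneTCQ.vars, OneTCQ.empty])).addCon B
    [false] (.inr List.mem_cons_self)

theorem Interp.satQuery_conQuery {I : Interp} {B : ConceptName} {a : IndName} :
    I.SatQuery (conQuery B) a ↔ I.ind a ∈ I.con B := by
  constructor
  · rintro ⟨π, h, hm⟩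
    rw [← h]
    exact hm _ List.mem_cons_self
  · intro h
    refine ⟨fun _ => I.ind a, rfl, fun α hα => ?_⟩
    obtain rfl : α = .con B [] := by simpa [conQuery, OneTCQ.addCon, OneTCQ.empty] using hα
    exact h

theorem Interp.satQuery_roleQuery {I : Interp} {r : Role} {B : ConceptName} {a : IndName} :
    I.SatQuery (roleQuery r B) a ↔ ∃ e, I.role r (I.ind a) e ∧ e ∈ I.con B := by
  constructor
  · rintro ⟨π, h, hm⟩
    change π [] = _ at h
    have h₁ := hm _ List.mem_cons_self
    have h₂ := hm _ (List.mem_cons_of_mem _ List.mem_cons_self)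
    rw [OneTCQ.satAtom_roleAtom, h] at h₂
    exact ⟨_, h₂, h₁⟩
  · rintro ⟨e, h₁, h₂⟩
    refine ⟨Function.update (fun _ => I.ind a) [false] e, rfl, fun α hα => ?_⟩
    have : α = .con B [false] ∨ α = OneTCQ.roleAtom r [] [false] := by
      simpa [roleQuery, OneTCQ.addCon, OneTCQ.addRole, OneTCQ.empty] using hα
    rcases this with rfl | rfl
    · simpa [SatAtom] using h₂
    · rw [OneTCQ.satAtom_roleAtom]
      simpa using h₁

def TBox.Over (S : Sig) (T : TBox) : Prop := ∀ α ∈ T.stmts, α.Over S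

namespace Interp

/-- Two copies of the interpretation, with roles only between different copies. -/
def double (I : Interp) (f : IndName → I.Dom × Bool) (hf : Function.Injective f) : Interp :=
  I.pull Prod.fst (fun x y => x.2 ≠ y.2) f hf

variable {I : Interp} {f : IndName → I.Dom × Bool} {hf : Function.Injective f}

theorem double_role (r : Role) (x y : I.Dom × Bool) :
    (I.double f hf).role r x y ↔ I.role r x.1 y.1 ∧ x.2 ≠ y.2 :=
  pull_role (fun _ _ h => h.symm) r x y

theorem double_modelOfTBox {T : TBox} {S : Sig} (hT : T.Over S) (hI : I.ModelOfTBox T) :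
    (I.double f hf).ModelOfTBox T := fun α hα =>
  pull_sat (fun _ _ h => h.symm) (fun _ _ x e _ => ⟨(e, !x.2), rfl, by simp⟩)
    (fun x y y' h h' e => Prod.ext e (by
      revert h h'
      generalize x.2 = a, y.2 = b, y'.2 = c
      revert a b c
      decide)) (hT α hα) (hI α hα)

theorem setCon_con (I : Interp) (A : ConceptName) (P : Set I.Dom) : (I.setCon A P).con A = P :=
  Function.update_self ..

theorem setCon_con_of_ne (I : Interp) {A A' : ConceptName} (P : Set I.Dom) (h : A' ≠ A) :
    (I.setCon A P).con A' = I.con A' :=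
  Function.update_of_ne h ..

theorem setCon_modelOfTBox {T : TBox} {S : Sig} (hT : T.Over S) (hI : I.ModelOfTBox T)
    {B : ConceptName} (hB : B ∉ S.concepts) (P : Set I.Dom) : (I.setCon B P).ModelOfTBox T :=
  fun α hα => (setCon_sat I P hB (hT α hα)).2 (hI α hα)

end Interp

section Tests

variable {T : TBox} {S : Sig} {B : ConceptName}

/-- As B is fresh it can be emptied in any model, so the query is certain only if the ABox has no
model. The names `[false]` and `[true]` denote distinct elements, which is the clash with
functionality. -/
theorem entails_func_iff (hT : T.Over S) (hB : B ∉ S.concepts) (r : Role) :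
    T.Entails (.func r) ↔
      CertainAnswer T [roleAssertion r [] [false], roleAssertion r [] [true]] (conQuery B) [] := by
  constructor
  · intro h I hI hA
    have h₁ := (Interp.satAssertion_roleAssertion _ _ _).1 (hA _ List.mem_cons_self)
    have h₂ := (Interp.satAssertion_roleAssertion _ _ _).1
      (hA _ (List.mem_cons_of_mem _ List.mem_cons_self))
    simpa using I.ind_inj (h I hI _ _ _ h₁ h₂)
  · intro h I hI d e e' h₁ h₂
    by_contra hne
    -- Three distinct individuals are needed although `d` may equal `e` or `e'`. The two-fold
    -- covering separates them: `d` is taken from one copy, its neighbours from the other.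
    have hf₀ : Function.Injective fun a => (I.ind a, false) := fun a b h =>
      I.ind_inj (congrArg Prod.fst h)
    obtain ⟨f₁, hf₁, e₁, -⟩ := exists_ind_eq hf₀ [] (d, false)
    obtain ⟨f₂, hf₂, e₂, k₂⟩ := exists_ind_eq hf₁ [false] (e, true)
    obtain ⟨f₃, hf₃, e₃, k₃⟩ := exists_ind_eq hf₂ [true] (e', true)
    have e₂' : f₂ [] = (d, false) := by rw [k₂ [] (by simp) (by simp [e₁]), e₁]
    have e₁' : f₃ [] = (d, false) := by rw [k₃ [] (by simp) (by simp [e₂']), e₂']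
    have e₂'' : f₃ [false] = (e, true) := by rw [k₃ [false] (by simp) (by simp [e₂, hne]), e₂]
    have hm := Interp.setCon_modelOfTBox hT
      (Interp.double_modelOfTBox (f := f₃) (hf := hf₃) hT hI) hB ∅
    have := Interp.satQuery_conQuery.1 (h _ hm fun α hα => ?_)
    · rw [Interp.setCon_con] at this
      exact this.elim
    · simp only [List.mem_cons, List.not_mem_nil, or_false] at hα
      rcases hα with rfl | rfl <;>
        rw [Interp.satAssertion_roleAssertion, Interp.setCon_role] <;>
        refine (Interp.double_role _ _ _).2 ?_ <;>
        simp only [Interp.setCon, Interp.double, Interp.pull, e₁', e₂'', e₃]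
      · exact ⟨h₁, by simp⟩
      · exact ⟨h₂, by simp⟩

/-- The name B marks a single element and so forces the query to return to the given r-neighbour.
The covering takes care of the case of an r-loop. -/
theorem entails_ri_iff (hT : T.Over S) (hB : B ∉ S.concepts) (r s : Role) :
    T.Entails (.ri r s) ↔
      CertainAnswer T [roleAssertion r [] [false], .con B [false]] (roleQuery s B) [] := by
  constructor
  · intro h I hI hA
    have h₁ := (Interp.satAssertion_roleAssertion _ _ _).1 (hA _ List.mem_cons_self)
    have h₂ := hA _ (List.mem_cons_of_mem _ List.mem_cons_self)
    exact Interp.satQuery_roleQuery.2 ⟨_, h I hI _ _ h₁, h₂⟩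
  · intro h I hI d e h₁
    have hf₀ : Function.Injective fun a => (I.ind a, false) := fun a b h =>
      I.ind_inj (congrArg Prod.fst h)
    obtain ⟨f₁, hf₁, e₁, -⟩ := exists_ind_eq hf₀ [] (d, false)
    obtain ⟨f₂, hf₂, e₂, k₂⟩ := exists_ind_eq hf₁ [false] (e, true)
    have e₂' : f₂ [] = (d, false) := by rw [k₂ [] (by simp) (by simp [e₁]), e₁]
    have hm := Interp.setCon_modelOfTBox hT
      (Interp.double_modelOfTBox (f := f₂) (hf := hf₂) hT hI) hB {(e, true)}
    have hA : ((I.double f₂ hf₂).setCon B {(e, true)}).ModelOfABox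
        [roleAssertion r [] [false], .con B [false]] := by
      intro α hα
      simp only [List.mem_cons, List.not_mem_nil, or_false] at hα
      rcases hα with rfl | rfl
      · rw [Interp.satAssertion_roleAssertion, Interp.setCon_role]
        refine (Interp.double_role _ _ _).2 ?_
        simp only [Interp.setCon, Interp.double, Interp.pull, e₂, e₂']
        exact ⟨h₁, by simp⟩
      · change f₂ [false] ∈ ((I.double f₂ hf₂).setCon B {(e, true)}).con B
        rw [Interp.setCon_con, e₂]
        rfl
    obtain ⟨x, hx, hx'⟩ := Interp.satQuery_roleQuery.1 (h _ hm hA)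
    rw [Interp.setCon_con] at hx'
    obtain rfl : x = (e, true) := hx'
    rw [Interp.setCon_role] at hx
    have := ((Interp.double_role _ _ _).1 hx).1
    simpa only [Interp.setCon, Interp.double, Interp.pull, e₂'] using this

/-- Unsatisfiable concepts are recognized by a query. -/
theorem hasBot_iff {T : TBox} {D : Concept} (hT : T.stmts = [.ci .top D]) (hD : D.Over S)
    {B X : ConceptName} (hX : X ∉ S.concepts) (hBX : B ≠ X) :
    D.HasBot ↔ CertainAnswer T [.con B []] (conQuery X) [] := by
  constructor
  · intro h I hI _
    have := hI (.ci .top D) (by simp [hT]) (show I.ind [] ∈ _ from trivial)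
    rw [I.ext_eq_empty h] at this
    exact this.elim
  · intro h
    by_contra hbot
    -- In this interpretation only X is empty; a ⊥-free D without X holds everywhere, self-loops
    -- serving as witnesses.
    have := Interp.satQuery_conQuery.1 (h (.loops {X}) ?_ ?_)
    · exact this rfl
    · intro α hα
      rw [hT, List.mem_singleton] at hα
      subst hα
      exact fun d _ => Interp.mem_loops_ext (by rintro _ rfl; exact hX) hbot hD d
    · intro α hα
      rw [List.mem_singleton] at hα
      subst hα
      exact hBX

end Tests

/-! ## Contradictions as a concept name -/

open Classical in
/-- The concept name `B` replaces contradictory right-hand sides. -/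
noncomputable def Stmt.tame (B : ConceptName) : Stmt → Stmt
  | .ci C D => if D.HasBot then .ci C (.atom B) else .ci C D
  | .ri r s => .ri r s
  | .func r => .func r

/-- The concept name `B` implies everything and spreads along the role. -/
def spread (B : ConceptName) (n : List Bool) : List Stmt :=
  [.ci (.atom B) (.atom n),
    .ci (.atom B) (.ex (.fwd n) (.atom B)), .ci (.atom B) (.ex (.bwd n) (.atom B)),
    .ci (.ex (.fwd n) (.atom B)) (.atom B), .ci (.ex (.bwd n) (.atom B)) (.atom B)]

/-- A TBox without contradictions that has `B` for `⊥` and `X` for `⊤`. -/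
noncomputable def tameStmts (B X : ConceptName) (N : List (List Bool)) (T : List Stmt) :
    List Stmt :=
  N.foldl (fun l n => spread B n ++ l) (T.foldl (fun l α => α.tame B :: l) [.ci .top (.atom X)])

theorem mem_tameStmts {B X : ConceptName} {N : List (List Bool)} {T : List Stmt} {α : Stmt} :
    α ∈ tameStmts B X N T ↔
      α = .ci .top (.atom X) ∨ (∃ β ∈ T, α = β.tame B) ∨ ∃ n ∈ N, α ∈ spread B n := by
  have h₁ : ∀ l, α ∈ T.foldl (fun l α => α.tame B :: l) l ↔ α ∈ l ∨ ∃ β ∈ T, α = β.tame B := by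
    induction T with
    | nil => simp
    | cons β T ih =>
      intro l
      rw [List.foldl_cons, ih]
      simp only [List.mem_cons, exists_eq_or_imp]
      tauto
  have h₂ : ∀ l, α ∈ N.foldl (fun l n => spread B n ++ l) l ↔ α ∈ l ∨ ∃ n ∈ N, α ∈ spread B n := by
    induction N with
    | nil => simp
    | cons n N ih =>
      intro l
      rw [List.foldl_cons, ih]
      simp only [List.mem_cons, List.mem_append, exists_eq_or_imp]
      tauto
  rw [tameStmts, h₂, h₁, List.mem_singleton, or_assoc]

noncomputable def TBox.tame (B X : ConceptName) (N : List (List Bool)) (T : TBox) : TBox where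
  stmts := tameStmts B X N T.stmts
  no_subrole := by
    have hri : ∀ {r s}, .ri r s ∈ tameStmts B X N T.stmts → .ri r s ∈ T.stmts := by
      intro r s h
      rcases mem_tameStmts.1 h with h | ⟨β, hβ, h⟩ | ⟨n, -, h⟩
      · cases h
      · cases β with
        | ci C D => simp only [Stmt.tame] at h; split at h <;> cases h
        | ri r s => rwa [h]
        | func r => cases h
      · simp [spread] at h
    have hfu : ∀ {r}, .func r ∈ tameStmts B X N T.stmts → .func r ∈ T.stmts := by
      intro r h
      rcases mem_tameStmts.1 h with h | ⟨β, hβ, h⟩ | ⟨n, -, h⟩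
      · cases h
      · cases β with
        | ci C D => simp only [Stmt.tame] at h; split at h <;> cases h
        | ri r s => cases h
        | func r => rwa [h]
      · simp [spread] at h
    exact fun r s h => ⟨fun h' => (T.no_subrole r s (hri h)).1 (hfu h'),
      fun h' => (T.no_subrole r s (hri h)).2 (hfu h')⟩

theorem TBox.func_mem_tame {B X : ConceptName} {N : List (List Bool)} {T : TBox} {r : Role}
    (h : .func r ∈ (T.tame B X N).stmts) : .func r ∈ T.stmts := by
  rcases mem_tameStmts.1 h with h | ⟨β, hβ, h⟩ | ⟨n, -, h⟩
  · cases h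
  · cases β with
    | ci C D => simp only [Stmt.tame] at h; split at h <;> cases h
    | ri r s => cases h
    | func r => rwa [h]
  · simp [spread] at h

/-- The signature of all names from a list. -/
def Sig.ofNames (N : List (List Bool)) : Sig := ⟨N, N⟩

/-- Two concept names are added. -/
def Sig.extend (S : Sig) (B X : ConceptName) : Sig := ⟨B :: X :: S.concepts, S.roles⟩

theorem Concept.Over.mono {S S' : Sig} (hc : S.concepts ⊆ S'.concepts) (hr : S.roles ⊆ S'.roles)
    {C : Concept} (h : C.Over S) : C.Over S' := by
  induction C with
  | top => trivial
  | bot => trivial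
  | atom A => exact hc h
  | and C D hC hD => exact ⟨hC h.1, hD h.2⟩
  | ex r C hC => exact ⟨hr h.1, hC h.2⟩

theorem Concept.Over.extend {S : Sig} {B X : ConceptName} {C : Concept} (h : C.Over S) :
    C.Over (S.extend B X) :=
  Concept.Over.mono (S' := S.extend B X)
    (fun _ h => List.mem_cons_of_mem _ (List.mem_cons_of_mem _ h)) (List.Subset.refl _) h

/-- `B` is empty and `X` is full. -/
def Interp.mark (I : Interp) (B X : ConceptName) : Interp :=
  (I.setCon B ∅).setCon X Set.univ

section Tame

variable {B X : ConceptName} {N : List (List Bool)} {T : TBox}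

theorem Interp.mark_ext (I : Interp) {S : Sig} (hB : B ∉ S.concepts) (hX : X ∉ S.concepts)
    {C : Concept} (hC : C.Over S) : (I.mark B X).ext C = I.ext C :=
  (setCon_ext _ _ hX hC).trans (setCon_ext _ _ hB hC)

theorem Interp.mark_con_left (I : Interp) (hBX : B ≠ X) : (I.mark B X).con B = ∅ :=
  (setCon_con_of_ne _ _ hBX).trans (setCon_con ..)

theorem Interp.mark_con_right (I : Interp) : (I.mark B X).con X = Set.univ :=
  setCon_con ..

theorem Interp.mark_con (I : Interp) {A : ConceptName} (hB : A ≠ B) (hX : A ≠ X) :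
    (I.mark B X).con A = I.con A :=
  (setCon_con_of_ne _ _ hX).trans (setCon_con_of_ne _ _ hB)

/-- With B empty the spreading axioms are vacuous, and a CI whose right-hand side contains ⊥ already
forces its left-hand side to be empty. -/
theorem Interp.mark_modelOfTBox {I : Interp} (hT : T.Over (.ofNames N)) (hB : B ∉ N) (hX : X ∉ N)
    (hBX : B ≠ X) (hI : I.ModelOfTBox T) : (I.mark B X).ModelOfTBox (T.tame B X N) := by
  have hI' : (I.mark B X).ModelOfTBox T :=
    setCon_modelOfTBox hT (setCon_modelOfTBox hT hI (S := .ofNames N) hB _) (S := .ofNames N) hX _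
  have hempty : (I.mark B X).ext (.atom B) = ∅ := I.mark_con_left hBX
  intro α hα
  rcases mem_tameStmts.1 hα with rfl | ⟨β, hβ, rfl⟩ | ⟨n, -, hα⟩
  · exact (I.mark_con_right.symm.subset : Set.univ ⊆ _)
  · have := hI' β hβ
    cases β with
    | ci C D =>
      simp only [Stmt.tame]
      split
      · next h =>
        simp only [Sat, ext_eq_empty _ h] at this
        exact this.trans (Set.empty_subset _)
      · exact this
    | ri r s => exact this
    | func r => exact this
  · simp only [spread, List.mem_cons, List.not_mem_nil, or_false] at hα
    rcases hα with rfl | rfl | rfl | rfl | rfl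
    · exact hempty.trans_subset (Set.empty_subset _)
    · exact hempty.trans_subset (Set.empty_subset _)
    · exact hempty.trans_subset (Set.empty_subset _)
    · rintro d ⟨e, -, he⟩
      rw [hempty] at he
      exact he.elim
    · rintro d ⟨e, -, he⟩
      rw [hempty] at he
      exact he.elim


/-- This holds for inverse roles too, so roles never connect B with its complement; the
decomposition of models depends on it. -/
theorem mem_con_of_role {J : Interp} (hJ : J.ModelOfTBox (T.tame B X N)) {r : Role}
    (hr : r.Over (.ofNames N)) {d e : J.Dom} (h : J.role r d e) (he : e ∈ J.con B) :
    d ∈ J.con B := by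
  cases r with
  | fwd n =>
    exact hJ (.ci (.ex (.fwd n) (.atom B)) (.atom B))
      (mem_tameStmts.2 (.inr (.inr ⟨n, hr, by simp [spread]⟩))) ⟨e, h, he⟩
  | bwd n =>
    exact hJ (.ci (.ex (.bwd n) (.atom B)) (.atom B))
      (mem_tameStmts.2 (.inr (.inr ⟨n, hr, by simp [spread]⟩))) ⟨e, h, he⟩

theorem con_eq_univ_of_tame {J : Interp} (hJ : J.ModelOfTBox (T.tame B X N)) :
    J.con X = Set.univ :=
  Set.univ_subset_iff.1 (hJ (.ci .top (.atom X)) (mem_tameStmts.2 (.inl rfl)))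

/-- Everything holds at the elements of `B`. -/
theorem mem_ext_of_mem_con {J : Interp} (hJ : J.ModelOfTBox (T.tame B X N)) {S : Sig}
    (hc : S.concepts ⊆ N) (hr : S.roles ⊆ N) {C : Concept} (hC : ¬ C.HasBot)
    (hS : C.Over (S.extend B X)) {d : J.Dom} (hd : d ∈ J.con B) : d ∈ J.ext C := by
  induction C generalizing d with
  | top => trivial
  | bot => exact absurd trivial hC
  | atom A =>
    rcases List.mem_cons.1 hS with rfl | hS
    · exact hd
    rcases List.mem_cons.1 hS with rfl | hS
    · rw [Interp.ext, con_eq_univ_of_tame hJ]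
      trivial
    · exact hJ (.ci (.atom B) (.atom A))
        (mem_tameStmts.2 (.inr (.inr ⟨A, hc hS, by simp [spread]⟩))) hd
  | and C D ihC ihD =>
    exact ⟨ihC (fun h => hC (.inl h)) hS.1 hd, ihD (fun h => hC (.inr h)) hS.2 hd⟩
  | ex r C ih =>
    have : ∃ e, J.role r d e ∧ e ∈ J.con B := by
      have hr' : r.name ∈ N := hr hS.1
      cases r with
      | fwd n =>
        exact hJ (.ci (.atom B) (.ex (.fwd n) (.atom B)))
          (mem_tameStmts.2 (.inr (.inr ⟨n, hr', by simp [spread]⟩))) hd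
      | bwd n =>
        exact hJ (.ci (.atom B) (.ex (.bwd n) (.atom B)))
          (mem_tameStmts.2 (.inr (.inr ⟨n, hr', by simp [spread]⟩))) hd
    obtain ⟨e, hde, he⟩ := this
    exact ⟨e, hde, ih hC hS.2 he⟩

/-- Copies of the part of an interpretation where `B` does not hold. -/
def Interp.consistentPart (J : Interp) (B : ConceptName)
    (f : IndName → {d // d ∉ J.con B} × Option IndName) (hf : Function.Injective f) : Interp :=
  J.pull (fun x => x.1.1) (fun x y => x.2 = y.2) f hf

section ConsistentPart

variable {J : Interp} {f : IndName → {d // d ∉ J.con B} × Option IndName}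
  {hf : Function.Injective f}

theorem consistentPart_lift (hJ : J.ModelOfTBox (T.tame B X N)) (r : Role)
    (hr : r.Over (.ofNames N)) (x : {d // d ∉ J.con B} × Option IndName) (e : J.Dom)
    (h : J.role r x.1.1 e) :
    ∃ y : {d // d ∉ J.con B} × Option IndName, y.1.1 = e ∧ x.2 = y.2 :=
  ⟨(⟨e, fun he => x.1.2 (mem_con_of_role hJ hr h he)⟩, x.2), rfl, rfl⟩

theorem consistentPart_ext (hJ : J.ModelOfTBox (T.tame B X N)) {C : Concept}
    (hC : C.Over (.ofNames N)) (x : {d // d ∉ J.con B} × Option IndName) :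
    x ∈ (J.consistentPart B f hf).ext C ↔ x.1.1 ∈ J.ext C :=
  Interp.pull_ext (fun _ _ h => h.symm) (consistentPart_lift hJ) hC x

/-- The part is closed under neighbours, so concepts keep their meaning. Tamed CIs that conclude B
cannot fire outside B, which is what their ⊥-versions demand. -/
theorem consistentPart_modelOfTBox (hT : T.Over (.ofNames N))
    (hJ : J.ModelOfTBox (T.tame B X N)) : (J.consistentPart B f hf).ModelOfTBox T := by
  intro α hα
  have hover := hT α hα
  have hsat := hJ (α.tame B) (mem_tameStmts.2 (.inr (.inl ⟨α, hα, rfl⟩)))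
  have huniq : ∀ x y y' : {d // d ∉ J.con B} × Option IndName, x.2 = y.2 → x.2 = y'.2 →
      y.1.1 = y'.1.1 → y = y' := fun x y y' h h' e => Prod.ext (Subtype.ext e) (h.symm.trans h')
  cases α with
  | ci C D =>
    simp only [Stmt.tame] at hsat
    split at hsat
    · intro x hx
      exact absurd (hsat ((consistentPart_ext hJ hover.1 x).1 hx)) x.1.2
    · exact Interp.pull_sat (fun _ _ h => h.symm) (consistentPart_lift hJ) huniq hover hsat
  | ri r s =>
    exact Interp.pull_sat (fun _ _ h => h.symm) (consistentPart_lift hJ) huniq hover hsat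
  | func r =>
    exact Interp.pull_sat (fun _ _ h => h.symm) (consistentPart_lift hJ) huniq hover hsat

/-- Outside `B`, the consequences of the original TBox hold. -/
theorem mem_ext_of_entails (hT : T.Over (.ofNames N)) (hJ : J.ModelOfTBox (T.tame B X N))
    {C D : Concept} (hC : C.Over (.ofNames N)) (hD : D.Over (.ofNames N))
    (h : T.Entails (.ci C D)) {d : J.Dom} (hd : d ∉ J.con B) (hdC : d ∈ J.ext C) :
    d ∈ J.ext D := by
  -- Only finitely many elements may lie outside B, so the copies indexed by names supply distinct
  -- denotations.
  let f : IndName → {d // d ∉ J.con B} × Option IndName := fun a => (⟨d, hd⟩, some a)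
  have hf : Function.Injective f := fun a b h => Option.some.inj (congrArg Prod.snd h)
  have := h (J.consistentPart B f hf) (consistentPart_modelOfTBox hT hJ)
  exact (consistentPart_ext hJ hD (⟨d, hd⟩, none)).1
    (this ((consistentPart_ext hJ hC (⟨d, hd⟩, none)).2 hdC))

end ConsistentPart

/-- In marked interpretations the two additional names are superfluous. -/
theorem exists_concept_of_extend {S : Sig} (hB : B ∉ S.concepts) (hX : X ∉ S.concepts)
    (hBX : B ≠ X) {C : Concept} (hC : C.Over (S.extend B X)) :
    ∃ D : Concept, D.Over S ∧ (∀ I : Interp, I.con X = Set.univ → I.ext D ⊆ I.ext C) ∧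
      ∀ I : Interp, (I.mark B X).ext C ⊆ I.ext D := by
  induction C with
  | top => exact ⟨.top, trivial, fun _ _ => subset_rfl, fun _ => subset_rfl⟩
  | bot => exact ⟨.bot, trivial, fun _ _ => subset_rfl, fun _ => subset_rfl⟩
  | atom A =>
    rcases List.mem_cons.1 hC with rfl | hC
    · exact ⟨.bot, trivial, fun _ _ => Set.empty_subset _, fun I => (I.mark_con_left hBX).subset⟩
    rcases List.mem_cons.1 hC with rfl | hC
    · exact ⟨.top, trivial, fun I hI => hI.symm.subset, fun I => Set.subset_univ _⟩
    · exact ⟨.atom A, hC, fun _ _ => subset_rfl, fun I =>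
        (I.mark_con (fun h : A = B => hB (h ▸ hC)) (fun h : A = X => hX (h ▸ hC))).subset⟩
  | and C D ihC ihD =>
    obtain ⟨C', h₁, h₂, h₃⟩ := ihC hC.1
    obtain ⟨D', h₁', h₂', h₃'⟩ := ihD hC.2
    exact ⟨.and C' D', ⟨h₁, h₁'⟩, fun I hI => Set.inter_subset_inter (h₂ I hI) (h₂' I hI),
      fun I => Set.inter_subset_inter (h₃ I) (h₃' I)⟩
  | ex r C ih =>
    obtain ⟨C', h₁, h₂, h₃⟩ := ih hC.2
    refine ⟨.ex r C', ⟨hC.1, h₁⟩, fun I hI d ⟨e, hde, he⟩ => ⟨e, hde, h₂ I hI he⟩, fun I d => ?_⟩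
    rintro ⟨e, hde, he⟩
    simp only [Interp.mark, Interp.setCon_role] at hde
    exact ⟨e, hde, h₃ I he⟩

end Tame

/-! ## Deductive entailment and query entailment -/

section Reduction

variable {B X : ConceptName} {N : List (List Bool)} {T₁ T₂ : TBox} {S : Sig}

/-- A model of the tamed T₁ is split at B. Outside B deductive entailment permits a canonical model
of T₂; inside B it is replaced by a model M from the consistency assumption. Their disjoint union is
a model of the tamed T₂ and of the ABox, where the certain answer can be read off. -/
theorem oneTCQEntails_of_deductivelyEntails (hT₁ : T₁.Over (.ofNames N))
    (hT₂ : T₂.Over (.ofNames N)) (hc : S.concepts ⊆ N) (hr : S.roles ⊆ N) (hB : B ∉ N)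
    (hX : X ∉ N) (hBX : B ≠ X) (h : DeductivelyEntails S T₁ T₂) :
    OneTCQEntails (S.extend B X) (S.extend B X) (T₁.tame B X N) (T₂.tame B X N) := by
  rintro A hA - ⟨M, hM, hMA⟩ q hq a - hcert I hI hIA
  obtain ⟨C, hC, hCbot, hCq⟩ := exists_concept_of_query hq
  refine (hCq I _).2 ?_
  by_cases ha : I.ind a ∈ I.con B
  · exact mem_ext_of_mem_con hI hc hr hCbot hC ha
  classical
  -- Individuals outside B keep their element in the copy `none`; those in B receive dummy elements
  -- in separate copies.
  let f : IndName → {d // d ∉ I.con B} × Option IndName := fun b =>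
    if hb : I.ind b ∉ I.con B then (⟨I.ind b, hb⟩, none) else (⟨I.ind a, ha⟩, some b)
  have hf : Function.Injective f := by
    intro b c hbc
    simp only [f] at hbc
    split at hbc <;> split at hbc <;> simp only [Prod.mk.injEq, Subtype.mk.injEq, Option.some.injEq,
      reduceCtorEq, and_false] at hbc
    · exact I.ind_inj hbc.1
    · exact hbc.2
  let K := I.consistentPart B f hf
  have hK : K.ModelOfTBox T₁ := consistentPart_modelOfTBox hT₁ hI
  obtain ⟨J, g, hJ, hg, hJind, hJcon, hJrol, hJext⟩ := exists_canonicalModel (T := T₂) (S := S)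
    (K := K) (fun r hrS hr => h (.func r) hrS (fun I hI => hI _ hr) K hK)
    (fun D hD hbot => Set.subset_empty_iff.1 (h (.ci D .bot) ⟨hD, trivial⟩ hbot K hK))
  have hfa : ∀ b (hb : I.ind b ∉ I.con B), f b = (⟨I.ind b, hb⟩, none) := fun b hb => dif_pos hb
  -- An individual is interpreted in M exactly if it lies in B in the given model.
  let i : IndName → (J.mark B X).Dom ⊕ M.Dom := fun b =>
    if I.ind b ∈ I.con B then .inr (M.ind b) else .inl (J.ind b)
  have hi : Function.Injective i := by
    intro b c hbc
    simp only [i] at hbc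
    split at hbc <;> split at hbc
    · exact M.ind_inj (Sum.inr.inj hbc)
    · cases hbc
    · cases hbc
    · exact J.ind_inj (Sum.inl.inj hbc)
  have hmark := Interp.mark_modelOfTBox hT₂ hB hX hBX hJ
  have hsum : ((J.mark B X).sum M i hi).ModelOfTBox (T₂.tame B X N) := fun α hα =>
    Interp.sum_sat (hmark α hα) (hM α hα)
  have hind : ∀ b, ((J.mark B X).sum M i hi).ind b = i b := fun _ => rfl
  have hsumA : ((J.mark B X).sum M i hi).ModelOfABox A := by
    intro α hα
    have h₁ := hA α hα
    have h₂ := hIA α hα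
    have h₃ := hMA α hα
    cases α with
    | con A' b =>
      simp only [Interp.SatAssertion, hind, i]
      split
      · exact h₃
      · next hb =>
        change J.ind b ∈ (J.mark B X).con A'
        rcases List.mem_cons.1 h₁ with rfl | h₁
        · exact absurd h₂ hb
        rcases List.mem_cons.1 h₁ with rfl | h₁
        · rw [J.mark_con_right]
          trivial
        · rw [J.mark_con (fun h : A' = B => hB (h ▸ hc h₁)) (fun h : A' = X => hX (h ▸ hc h₁)), hJind]
          refine hJcon A' h₁ _ ?_
          change (f b).1.1 ∈ I.con A'
          rw [hfa b hb]
          exact h₂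
    | rol r b c =>
      -- No role assertion crosses between the two summands, since B spreads in both directions.
      have hn : I.ind b ∈ I.con B ↔ I.ind c ∈ I.con B :=
        ⟨fun h => mem_con_of_role hI (r := .bwd r) (hr h₁) h₂ h,
          fun h => mem_con_of_role hI (r := .fwd r) (hr h₁) h₂ h⟩
      simp only [Interp.SatAssertion, hind, i]
      by_cases hb : I.ind b ∈ I.con B
      · rw [if_pos hb, if_pos (hn.1 hb)]
        exact h₃
      · have hc' := mt hn.2 hb
        rw [if_neg hb, if_neg hc']
        change J.rol r (J.ind b) (J.ind c)
        rw [hJind, hJind]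
        refine hJrol r h₁ _ _ ?_
        change I.rol r (f b).1.1 (f c).1.1 ∧ (f b).2 = (f c).2
        rw [hfa b hb, hfa c hc']
        exact ⟨h₂, rfl⟩
  have hmem := (hCq _ _).1 (hcert _ hsum hsumA)
  rw [Interp.sum_ext, hind, show i a = .inl (J.ind a) from if_neg ha] at hmem
  obtain ⟨C', h₁, h₂, h₃⟩ := exists_concept_of_extend (fun h => hB (hc h)) (fun h => hX (hc h))
    hBX hC
  have hmem := h₃ J hmem
  rw [hJind] at hmem
  obtain ⟨D, hD, hKD, hent⟩ := hJext C' _ hmem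
  -- The concept C' is forced in the canonical model by a Σ-concept D that holds in K; the resulting
  -- CI passes to T₁, of which K is a model.
  have := h (.ci D C') ⟨hD, h₁⟩ hent K hK hKD
  have := (consistentPart_ext (T := T₁) hI (h₁.mono hc hr) _).1 this
  change (f a).1.1 ∈ I.ext C' at this
  rw [hfa a ha] at this
  exact h₂ I (con_eq_univ_of_tame hI) this

/-- The finitely many facts that make a concept true. -/
theorem exists_abox (I : Interp) {C : Concept} {d : I.Dom} (hd : d ∈ I.ext C) (hC : C.Over S) :
    ∃ (f : IndName → I.Dom) (hf : Function.Injective f) (A : ABox) (a : IndName), f a = d ∧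
      A.Over S ∧ (I.withInd f hf).ModelOfABox A ∧
      ∀ J : Interp, J.ModelOfABox A → J.ind a ∈ J.ext C := by
  obtain ⟨q, hq, hqC⟩ := exists_query_of_concept
    (fun hbot => by rw [I.ext_eq_empty hbot] at hd; exact hd) hC
  obtain ⟨π, rfl, hm⟩ := (hqC I d).2 hd
  -- The individual names are reassigned so that all elements of the match have names; the atoms of
  -- the query then become assertions.
  obtain ⟨f, hf, hr⟩ := exists_ind_range I.ind_inj
    (((Set.finite_singleton q.ans).union (List.finite_toSet q.ex)).image π)
  have hname : ∀ z, ∃ b, z ∈ q.vars → f b = π z := fun z => by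
    by_cases hz : z ∈ q.vars
    · obtain ⟨b, hb⟩ := hr ⟨z, hz, rfl⟩
      exact ⟨b, fun _ => hb⟩
    · exact ⟨[], fun h => absurd h hz⟩
  choose n hn using hname
  let m : QAtom → Assertion := fun
    | .con A z => .con A (n z)
    | .rol r z z' => .rol r (n z) (n z')
  refine ⟨f, hf, q.atoms.map m, n q.ans, hn _ (.inl rfl), ?_, ?_, fun J hJ => ?_⟩
  · intro α hα
    obtain ⟨β, hβ, rfl⟩ := List.mem_map.1 hα
    have := hq β hβ
    cases β <;> exact this
  · intro α hα
    obtain ⟨β, hβ, rfl⟩ := List.mem_map.1 hα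
    have := hm β hβ
    have hv := q.vars_sub β hβ
    cases β with
    | con A z =>
      change f (n z) ∈ I.con A
      rw [hn z (hv z rfl)]
      exact this
    | rol r z z' =>
      change I.rol r (f (n z)) (f (n z'))
      rw [hn z (hv z (.inl rfl)), hn z' (hv z' (.inr rfl))]
      exact this
  · refine (hqC J _).1 ⟨fun z => J.ind (n z), rfl, fun β hβ => ?_⟩
    have := hJ _ (List.mem_map_of_mem (f := m) hβ)
    cases β <;> exact this

theorem Interp.modelOfABox_mark {I : Interp} {A : ABox} (hA : A.Over S) (hB : B ∉ S.concepts)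
    (hX : X ∉ S.concepts) (h : I.ModelOfABox A) : (I.mark B X).ModelOfABox A := by
  intro α hα
  have h₁ := hA α hα
  have h₂ := h α hα
  cases α with
  | con A' b =>
    change I.ind b ∈ (I.mark B X).con A'
    rw [I.mark_con (fun h : A' = B => hB (h ▸ h₁)) (fun h : A' = X => hX (h ▸ h₁))]
    exact h₂
  | rol r b c => exact h₂

/-- All concept names are full. -/
def Interp.full (I : Interp) : Interp where
  Dom := I.Dom
  con _ := Set.univ
  rol := I.rol
  ind := I.ind
  ind_inj := I.ind_inj

/-- With all concept names full and exactly a self-loop for each role at every element, every ⊥-free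
concept holds everywhere, and taming has removed ⊥ from all right-hand sides. -/
theorem TBox.tame_consistent (T : TBox) {D : Concept} (hbot : ¬ D.HasBot) :
    ¬ (T.tame B X N).Entails (.ci D .bot) := by
  intro h
  have hall : ∀ {C : Concept}, ¬ C.HasBot → ∀ d, d ∈ (Interp.loops ∅).ext C := by
    intro C hC d
    induction C generalizing d with
    | top => trivial
    | bot => exact hC trivial
    | atom A => exact Set.notMem_empty A
    | and C D ihC ihD =>
      exact ⟨ihC (fun h => hC (.inl h)) d, ihD (fun h => hC (.inr h)) d⟩
    | ex r C ih => exact ⟨d, (Interp.loops_role ∅ r d d).2 rfl, ih hC d⟩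
  refine h (.loops ∅) (fun α hα => ?_) (hall hbot [])
  have hci : ∀ {C D : Concept}, ¬ D.HasBot → (Interp.loops ∅).Sat (.ci C D) :=
    fun h d _ => hall h d
  rcases mem_tameStmts.1 hα with rfl | ⟨β, -, rfl⟩ | ⟨n, -, hα⟩
  · exact hci fun h => h
  · cases β with
    | ci C D =>
      simp only [Stmt.tame]
      split
      · exact hci fun h => h
      · next h => exact hci h
    | ri r s =>
      intro d e h
      exact (Interp.loops_role _ _ _ _).2 ((Interp.loops_role _ _ _ _).1 h)
    | func r =>
      intro d e e' h h'
      exact ((Interp.loops_role _ _ _ _).1 h).symm.trans ((Interp.loops_role _ _ _ _).1 h')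
  · simp only [spread, List.mem_cons, List.not_mem_nil, or_false] at hα
    rcases hα with rfl | rfl | rfl | rfl | rfl <;> exact hci fun h => h

/-- The model of T₁ with B emptied and X filled is tested on an ABox that describes C. In models of
the tamed T₂, the individual is either in B, where all ⊥-free concepts over the signature hold, or
outside, where T₂ itself yields D. -/
theorem entails_ci_of_oneTCQEntails (hT₁ : T₁.Over (.ofNames N))
    (hT₂ : T₂.Over (.ofNames N)) (hc : S.concepts ⊆ N) (hr : S.roles ⊆ N) (hB : B ∉ N)
    (hX : X ∉ N) (hBX : B ≠ X)
    (hfunc : ∀ r : Role, r.Over S → T₂.Entails (.func r) → T₁.Entails (.func r))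
    (h : OneTCQEntails (S.extend B X) (S.extend B X) (T₁.tame B X N) (T₂.tame B X N))
    {C D : Concept} (hC : C.Over S) (hD : D.Over S) (hCD : T₂.Entails (.ci C D)) :
    T₁.Entails (.ci C D) := by
  intro I hI d hd
  have hBS : B ∉ S.concepts := fun h => hB (hc h)
  have hXS : X ∉ S.concepts := fun h => hX (hc h)
  obtain ⟨f, hf, A₀, a, rfl, hA₀, hmA₀, hJA₀⟩ := exists_abox I hd hC
  -- The assertion X(a) makes `a` an individual of the ABox even if C, such as ⊤, produces no facts.
  let A : ABox := .con X a :: A₀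
  have hI' : (I.withInd f hf).ModelOfTBox T₁ := fun α hα => (I.withInd_sat hf α).2 (hI α hα)
  have hA : A.Over (S.extend B X) := by
    intro α hα
    rcases List.mem_cons.1 hα with rfl | hα
    · exact List.mem_cons_of_mem _ List.mem_cons_self
    · have := hA₀ α hα
      cases α with
      | con => exact List.mem_cons_of_mem _ (List.mem_cons_of_mem _ this)
      | rol => exact this
  have hI₁ := Interp.mark_modelOfTBox hT₁ hB hX hBX hI'
  have hI₁A : ((I.withInd f hf).mark B X).ModelOfABox A := by
    intro α hα
    rcases List.mem_cons.1 hα with rfl | hα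
    · change _ ∈ ((I.withInd f hf).mark B X).con X
      rw [Interp.mark_con_right]
      trivial
    · exact Interp.modelOfABox_mark hA₀ hBS hXS hmA₀ α hα
  have hcons : A.ConsistentWith (T₂.tame B X N) := by
    -- Full concept names do no harm, as the tamed T₂ derives no ⊥ from them; only the FAs need
    -- checking, and `hfunc` transfers them to T₁.
    let K := (I.withInd f hf).full
    obtain ⟨J, g, hJ, -, hJind, hJcon, hJrol, -⟩ := exists_canonicalModel (T := T₂.tame B X N)
      (S := S.extend B X) (K := K)
      (fun r hrS hr => by
        have := hfunc r hrS (fun I hI => hI _ (TBox.func_mem_tame hr)) I hI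
        cases r <;> exact this)
      (fun D _ hent => by
        by_contra hne
        obtain ⟨x, hx⟩ := Set.nonempty_iff_ne_empty.2 hne
        exact T₂.tame_consistent (fun hbot => by rw [K.ext_eq_empty hbot] at hx; exact hx) hent)
    refine ⟨J, hJ, fun α hα => ?_⟩
    have h₁ := hA α hα
    have h₂ := hI₁A α hα
    cases α with
    | con A' b =>
      change J.ind b ∈ J.con A'
      rw [hJind]
      exact hJcon A' h₁ _ trivial
    | rol r b c =>
      change J.rol r (J.ind b) (J.ind c)
      rw [hJind, hJind]
      exact hJrol r h₁ _ _ h₂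
  have hCa : ∀ J : Interp, J.ModelOfABox A → J.ind a ∈ J.ext C := fun J hJ =>
    hJA₀ J fun α hα => hJ α (List.mem_cons_of_mem _ hα)
  have hent := h A hA ⟨_, hI₁, hI₁A⟩ hcons
  have hain : a ∈ A.inds := ⟨_, List.mem_cons_self, rfl⟩
  have hmem : ∀ J : Interp, J.ModelOfTBox (T₂.tame B X N) → J.ModelOfABox A →
      J.ind a ∉ J.con B → J.ind a ∈ J.ext D := fun J hJ hJA hnB =>
    mem_ext_of_entails hT₂ hJ (hC.mono hc hr) (hD.mono hc hr) hCD hnB (hCa J hJA)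
  -- If D contains ⊥, no query expresses it; then B(x) is certain for the tamed T₂, while B is empty
  -- in the marked model.
  by_cases hbot : D.HasBot
  · have hq : (conQuery B).Over (S.extend B X) := by
      intro α hα
      obtain rfl : α = .con B [] := by simpa [conQuery, OneTCQ.addCon, OneTCQ.empty] using hα
      exact List.mem_cons_self
    have := hent _ hq a hain (fun J hJ hJA => by
      rw [Interp.satQuery_conQuery]
      by_contra hnB
      have := hmem J hJ hJA hnB
      rw [J.ext_eq_empty hbot] at this
      exact this) _ hI₁ hI₁A
    rw [Interp.satQuery_conQuery, Interp.mark_con_left _ hBX] at this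
    exact this.elim
  · obtain ⟨q, hq, hqD⟩ := exists_query_of_concept hbot (Concept.Over.extend (B := B) (X := X) hD)
    have := hent q hq a hain (fun J hJ hJA => by
      refine (hqD J _).2 ?_
      by_cases hnB : J.ind a ∈ J.con B
      · exact mem_ext_of_mem_con hJ hc hr hbot hD.extend hnB
      · exact hmem J hJ hJA hnB) _ hI₁ hI₁A
    have := (hqD _ _).1 this
    rw [Interp.mark_ext _ hBS hXS hD, Interp.withInd_ext] at this
    exact this

/-- Deductive entailment in terms of query entailment. -/
theorem deductivelyEntails_iff (hT₁ : T₁.Over (.ofNames N))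
    (hT₂ : T₂.Over (.ofNames N)) (hc : S.concepts ⊆ N) (hr : S.roles ⊆ N) (hB : B ∉ N)
    (hX : X ∉ N) (hBX : B ≠ X) :
    DeductivelyEntails S T₁ T₂ ↔
      (∀ r : Role, r.Over S → T₂.Entails (.func r) → T₁.Entails (.func r)) ∧
      (∀ r s : Role, r.Over S → s.Over S → T₂.Entails (.ri r s) → T₁.Entails (.ri r s)) ∧
      OneTCQEntails (S.extend B X) (S.extend B X) (T₁.tame B X N) (T₂.tame B X N) := by
  constructor
  · exact fun h => ⟨fun r hr => h _ hr, fun r s hr hs => h _ ⟨hr, hs⟩,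
      oneTCQEntails_of_deductivelyEntails hT₁ hT₂ hc hr hB hX hBX h⟩
  · rintro ⟨h₁, h₂, h₃⟩ (⟨C, D⟩ | ⟨r, s⟩ | r) hα
    · exact entails_ci_of_oneTCQEntails hT₁ hT₂ hc hr hB hX hBX h₁ h₃ hα.1 hα.2
    · exact h₂ r s hα.1 hα.2
    · exact h₁ r hα

end Reduction

/-! ## Derived computable functions -/

@[simp] theorem Data.hd_node (l r : Data) : (Data.node l r).hd = l := rfl

@[simp] theorem Data.tl_node (l r : Data) : (Data.node l r).tl = r := rfl

theorem SlowGrowth.acc : SlowGrowth fun _ _ a => a := ⟨0, fun _ _ a => by simp⟩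

section Derived

variable {ι : Type} {O : ι → Set Data}

theorem SlowGrowth.node {h : Data → Data} (hh : Computes O h) {g : Data → Data → Data → Data}
    (hg : SlowGrowth g) : SlowGrowth fun c x a => .node (h (.node c x)) (g c x a) := by
  obtain ⟨p, hp, -⟩ := hh
  obtain ⟨q, hq⟩ := hg
  refine ⟨p.comp (.X + 1) + q + 1, fun c x a => ?_⟩
  have h₁ := hp (.node c x)
  have h₂ := hq c x a
  simp only [Data.size] at h₁ ⊢
  simp only [Polynomial.eval_add, Polynomial.eval_comp, Polynomial.eval_X, Polynomial.eval_one]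
  omega

open Classical in
/-- The test `t` succeeds on all members of a list. -/
noncomputable def Data.all (t : Data → Data) (c l : Data) : Data :=
  Data.fold (fun c x a => if t (.node c x) = .nil then .nil else a) c l (.node .nil .nil)

theorem Computes.all {t : Data → Data} (ht : Computes O t) {c l : Data → Data}
    (hc : Computes O c) (hl : Computes O l) : Computes O fun d => Data.all t (c d) (l d) := by
  refine Computes.fold ?_ ⟨1, fun c x a => ?_⟩ hc hl (Computes.const _)
  · exact Computes.ite (ht.comp (f := fun d => .node d.hd d.tl.hd) (id.hd.node id.tl.hd)) id.tl.tl nil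
  · split <;> simp [Data.size]

theorem Data.fold_codeList {α β : Type} [Coded α] [Coded β] {g : Data → Data → Data → Data}
    {c : Data} {step : List β → α → List β} (l : List α)
    (h : ∀ x ∈ l, ∀ m, codeList (step m x) = g c (code x) (codeList m)) (a : List β) :
    Data.fold g c (codeList l) (codeList a) = codeList (l.foldl step a) := by
  induction l generalizing a with
  | nil => rfl
  | cons x l ih =>
    rw [codeList, Data.fold, ← h x List.mem_cons_self, ih fun y hy => h y (List.mem_cons_of_mem _ hy)]
    rfl

theorem Data.all_ne_nil {α : Type} [Coded α] {t : Data → Data} {c : Data} (l : List α) :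
    Data.all t c (codeList l) ≠ .nil ↔ ∀ x ∈ l, t (.node c (code x)) ≠ .nil := by
  classical
  have : ∀ a, Data.fold (fun c x a => if t (.node c x) = .nil then .nil else a) c (codeList l) a ≠
      .nil ↔ a ≠ .nil ∧ ∀ x ∈ l, t (.node c (code x)) ≠ .nil := by
    induction l with
    | nil => simp [codeList, Data.fold]
    | cons x l ih =>
      intro a
      rw [codeList, Data.fold, ih]
      split <;> simp_all
  rw [Data.all]
  refine (this _).trans ?_
  simp

/-! ## Names in the input -/

/-- The bit string that is coded by a tree. -/
def toName : Data → List Bool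
  | .nil => []
  | .node .nil r => false :: toName r
  | .node (.node _ _) r => true :: toName r

theorem toName_code (n : List Bool) : toName (code n) = n := by
  induction n with
  | nil => rfl
  | cons b n ih =>
    have : toName (codeList n) = n := ih
    cases b
    · change false :: toName (codeList n) = _
      rw [this]
    · change true :: toName (codeList n) = _
      rw [this]

theorem toName_length_lt (d : Data) : (toName d).length < d.size := by
  induction d with
  | nil => simp [toName, Data.size]
  | node l r _ ih => cases l <;> simp only [toName, List.length_cons, Data.size] at * <;> omega

open Classical in
/-- A tree is turned into the code of a bit string, in reverse. -/
noncomputable def normalizeRev (c l a : Data) : Data :=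
  Data.fold (fun _ x a => .node (if x = .nil then .nil else .node .nil .nil) a) c l a

theorem normalizeRev_eq (d : Data) (m : List Bool) :
    normalizeRev .nil d (code m) = code ((toName d).reverse ++ m) := by
  induction d generalizing m with
  | nil => rfl
  | node l r _ ih =>
    cases l with
    | nil =>
      have := ih (false :: m)
      simp only [toName, List.reverse_cons, List.append_assoc, List.singleton_append]
      rw [← this]
      simp [normalizeRev, Data.fold, code, codeList, codeBool, Data.num]
    | node =>
      have := ih (true :: m)
      simp only [toName, List.reverse_cons, List.append_assoc, List.singleton_append]
      rw [← this]
      simp [normalizeRev, Data.fold, code, codeList, codeBool, Data.num]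

theorem computes_name : Computes O fun d => code (toName d) := by
  have h : Computes O fun d => normalizeRev .nil d .nil := by
    refine Computes.fold ?_ ⟨4, fun c x a => ?_⟩ Computes.nil Computes.id Computes.nil
    · exact (Computes.ite Computes.id.tl.hd (Computes.const _) Computes.nil).node Computes.id.tl.tl
    · split <;> simp only [Data.size, Polynomial.eval_ofNat] <;> omega
  -- A left fold reverses the string, so the normalization is applied twice.
  refine (congrArg (Computes O) (funext fun d => ?_)).mp (h.comp h)
  have h₁ := normalizeRev_eq d []
  have h₂ := normalizeRev_eq (code (toName d).reverse) []
  rw [toName_code, List.reverse_reverse] at h₂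
  rw [List.append_nil] at h₁ h₂
  exact (congrArg (fun x => normalizeRev .nil x .nil) h₁).trans h₂

/-- Subtrees. -/
def Data.IsSub (y : Data) : Data → Prop
  | .nil => y = .nil
  | .node l r => y = .node l r ∨ y.IsSub l ∨ y.IsSub r

theorem Data.IsSub.refl (x : Data) : x.IsSub x := by
  cases x
  · rfl
  · exact .inl rfl

theorem Data.IsSub.of_node {l r x : Data} (h : (Data.node l r).IsSub x) : l.IsSub x ∧ r.IsSub x := by
  induction x with
  | nil => cases h
  | node a b iha ihb =>
    rcases h with h | h | h
    · cases h
      exact ⟨.inr (.inl (.refl l)), .inr (.inr (.refl r))⟩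
    · exact ⟨.inr (.inl (iha h).1), .inr (.inl (iha h).2)⟩
    · exact ⟨.inr (.inr (ihb h).1), .inr (.inr (ihb h).2)⟩

/-- The names of all subtrees are put on a list. -/
def visit : Data → List (List Bool) → List (List Bool)
  | .nil, N => [] :: N
  | .node l r, N => visit r (visit l (toName (.node l r) :: N))

theorem subset_visit (d : Data) (N : List (List Bool)) : N ⊆ visit d N := by
  induction d generalizing N with
  | nil => exact List.subset_cons_self _ _
  | node l r hl hr => exact fun n hn => hr _ (hl _ (List.mem_cons_of_mem _ hn))

/-- The code of each name of an instance is a subtree of the input, so the list contains all names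
without any parsing. Spurious entries are harmless, since the reduction only needs a superset. -/
theorem toName_mem_visit {y d : Data} (h : y.IsSub d) (N : List (List Bool)) :
    toName y ∈ visit d N := by
  induction d generalizing N with
  | nil =>
    obtain rfl : y = .nil := h
    exact List.mem_cons_self
  | node l r hl hr =>
    rcases h with rfl | h | h
    · exact subset_visit r _ (subset_visit l _ List.mem_cons_self)
    · exact subset_visit r _ (hl h _)
    · exact hr h _

/-- For the empty initial list this makes every string whose length is at least the size of the
input fresh. -/
theorem length_lt_of_mem_visit {d : Data} {N : List (List Bool)} {n : List Bool}
    (h : n ∈ visit d N) : n ∈ N ∨ n.length < d.size := by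
  induction d generalizing N with
  | nil =>
    rcases List.mem_cons.1 h with rfl | h
    · exact .inr Nat.zero_lt_one
    · exact .inl h
  | node l r hl hr =>
    rcases hr h with h | h
    · rcases hl h with h | h
      · rcases List.mem_cons.1 h with rfl | h
        · exact .inr (toName_length_lt _)
        · exact .inl h
      · exact .inr (by simp only [Data.size]; omega)
    · exact .inr (by simp only [Data.size]; omega)

open Classical in
/-- One step of the traversal of the input: a stack of trees, a fresh name, a list of names. -/
noncomputable def visitStep (s : Data) : Data :=
  .node (if s.hd.hd = .nil then s.hd.tl else .node s.hd.hd.hd (.node s.hd.hd.tl s.hd.tl))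
    (.node (.node .nil s.tl.hd) (.node (code (toName s.hd.hd)) s.tl.tl))

theorem computes_visitStep : Computes O visitStep :=
  (Computes.ite Computes.id.hd.hd
    (Computes.id.hd.hd.hd.node (Computes.id.hd.hd.tl.node Computes.id.hd.tl)) Computes.id.hd.tl).node
    ((Computes.nil.node Computes.id.tl.hd).node
      ((computes_name.comp Computes.id.hd.hd).node Computes.id.tl.tl))

/-- Each step consumes one node, leaves included, and adds one bit to the fresh name, whose length
therefore increases by exactly the size of the tree. -/
theorem visitStep_iterate (d st : Data) (k : ℕ) (N : List (List Bool)) :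
    visitStep^[d.size] (.node (.node d st) (.node (code (List.replicate k false)) (code N))) =
      .node st (.node (code (List.replicate (k + d.size) false)) (code (visit d N))) ∧
    ∀ j < d.size, (visitStep^[j] (.node (.node d st)
      (.node (code (List.replicate k false)) (code N)))).hd ≠ .nil := by
  induction d generalizing st k N with
  | nil =>
    refine ⟨?_, fun j hj => ?_⟩
    · simp [Data.size, visitStep, Data.hd, Data.tl, visit, toName, code, codeList, codeBool, Data.num,
        List.replicate_succ]
    · simp only [Data.size, Nat.lt_one_iff] at hj
      subst hj
      simp [Data.hd]
  | node l r hl hr =>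
    have h₁ : visitStep (.node (.node (.node l r) st)
        (.node (code (List.replicate k false)) (code N))) =
        .node (.node l (.node r st)) (.node (code (List.replicate (k + 1) false))
          (code (toName (.node l r) :: N))) := by
      simp [visitStep, Data.hd, Data.tl, code, codeList, codeBool, Data.num, List.replicate_succ]
    have hl' := hl (.node r st) (k + 1) (toName (.node l r) :: N)
    have hr' := hr st (k + 1 + l.size) (visit l (toName (.node l r) :: N))
    constructor
    · rw [Data.size, show l.size + r.size + 1 = (r.size + l.size) + 1 by omega,
        Function.iterate_succ_apply, h₁, Function.iterate_add_apply, hl'.1, hr'.1, visit,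
        show k + 1 + l.size + r.size = k + (r.size + l.size + 1) by omega]
    · rintro (_ | j) hj
      · simp [Data.hd]
      · rw [Function.iterate_succ_apply, h₁]
        by_cases hjl : j < l.size
        · exact hl'.2 j hjl
        · rw [show j = (j - l.size) + l.size by omega, Function.iterate_add_apply, hl'.1]
          simp only [Data.size] at hj
          exact hr'.2 _ (by omega)

/-- A fresh name and the list of all names of the input. -/
def freshAndNames (d : Data) : Data :=
  .node (code (List.replicate d.size false)) (code (visit d []))

theorem computes_freshAndNames : Computes O freshAndNames := by
  obtain ⟨p, hp, -⟩ := computes_name (O := O)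
  -- Replacing a tree on the stack by its two subtrees leaves the size of the stack unchanged, so
  -- each recorded name stays polynomial.
  have hstep₁ : ∀ s, (visitStep s).hd.size ≤ s.hd.size := by
    intro s
    simp only [visitStep, Data.hd_node]
    generalize s.hd = x
    split
    · exact Data.size_tl_le _
    · next h =>
      rcases x with _ | ⟨_ | ⟨l, r⟩, y⟩
      · exact absurd rfl h
      · exact absurd rfl h
      · simp only [Data.size, Data.hd_node, Data.tl_node]
        omega
  have hstep₂ : ∀ s, (visitStep s).tl.size ≤ s.tl.size + p.eval s.hd.size + 5 := by
    intro s
    have h₁ := (hp s.hd.hd).trans (eval_mono_nat p (Data.size_hd_le _))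
    have h₂ : s.tl.hd.size + s.tl.tl.size ≤ s.tl.size + 1 := by
      generalize s.tl = x
      cases x
      · simp [Data.hd, Data.tl, Data.size]
      · simp only [Data.hd_node, Data.tl_node, Data.size]
        omega
    simp only [visitStep, Data.tl_node, Data.size] at h₁ ⊢
    omega
  have hiter : ∀ s j, (visitStep^[j] s).hd.size ≤ s.hd.size ∧
      (visitStep^[j] s).tl.size ≤ s.tl.size + j * (p.eval s.hd.size + 5) := by
    intro s j
    induction j with
    | zero => simp
    | succ j ih =>
      rw [Function.iterate_succ_apply']
      refine ⟨(hstep₁ _).trans ih.1, (hstep₂ _).trans ?_⟩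
      have := eval_mono_nat p ih.1
      rw [Nat.succ_mul]
      omega
  have hsize : ∀ s : Data, s.size ≤ s.hd.size + s.tl.size + 1 := by
    rintro (_ | _)
    · simp [Data.size]
    · simp only [Data.hd_node, Data.tl_node, Data.size]
      omega
  have h : Computes O fun d => Data.node .nil (freshAndNames d) := by
    refine Computes.loop (init := fun d => .node (.node d .nil) (.node .nil .nil)) (test := Data.hd)
      (step := visitStep) ((Computes.id.node Computes.nil).node (Computes.const _)) Computes.hd_fun
      computes_visitStep (.X + 6 + .X * (p.comp (.X + 2) + 5)) fun d => ?_
    have hv := visitStep_iterate d .nil 0 []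
    refine ⟨d.size, ?_, hv.2, ?_, fun j hj => ?_, ?_⟩
    · simp only [Polynomial.eval_add, Polynomial.eval_X]
      omega
    · refine (congrArg Data.hd hv.1).trans rfl
    · have h₁ := hiter (.node (.node d .nil) (.node .nil .nil)) j
      have h₂ := hsize (visitStep^[j] (.node (.node d .nil) (.node .nil .nil)))
      have h₃ := Nat.mul_le_mul_right (p.eval (d.size + 2) + 5) hj
      simp only [Data.hd_node, Data.tl_node, Data.size] at h₁
      simp only [Polynomial.eval_add, Polynomial.eval_mul, Polynomial.eval_comp, Polynomial.eval_X,
        Polynomial.eval_ofNat]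
      rw [show d.size + 1 + 1 = d.size + 2 by omega] at h₁
      omega
    · refine Eq.symm (hv.1.trans ?_)
      rw [Nat.zero_add]
      rfl
  exact h.tl

end Derived

/-! ## The names of an instance -/

section Names

variable {d : Data} {N : List (List Bool)}

theorem mem_of_isSub (hN : ∀ y : Data, y.IsSub d → toName y ∈ N) {n : List Bool}
    (h : (code n).IsSub d) : n ∈ N := by
  have := hN _ h
  rwa [toName_code] at this

theorem isSub_of_mem {α : Type} [Coded α] {l : List α} (h : (codeList l).IsSub d) {x : α}
    (hx : x ∈ l) : (code x).IsSub d := by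
  induction l with
  | nil => cases hx
  | cons y l ih =>
    rcases List.mem_cons.1 hx with rfl | hx
    · exact h.of_node.1
    · exact ih h.of_node.2 hx

theorem role_over_of_isSub (hN : ∀ y : Data, y.IsSub d → toName y ∈ N) {r : Role}
    (h : (codeRole r).IsSub d) : r.Over (.ofNames N) := by
  cases r <;> exact mem_of_isSub hN h.of_node.2

theorem concept_over_of_isSub (hN : ∀ y : Data, y.IsSub d → toName y ∈ N) {C : Concept}
    (h : (codeConcept C).IsSub d) : C.Over (.ofNames N) := by
  induction C with
  | top => trivial
  | bot => trivial
  | atom A => exact mem_of_isSub hN h.of_node.2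
  | and C D hC hD => exact ⟨hC h.of_node.2.of_node.1, hD h.of_node.2.of_node.2⟩
  | ex r C hC => exact ⟨role_over_of_isSub hN h.of_node.2.of_node.1, hC h.of_node.2.of_node.2⟩

theorem tbox_over_of_isSub (hN : ∀ y : Data, y.IsSub d → toName y ∈ N) {T : TBox}
    (h : (code T).IsSub d) : T.Over (.ofNames N) := by
  intro α hα
  have : (codeStmt α).IsSub d := isSub_of_mem (l := T.stmts) h hα
  cases α with
  | ci C D =>
    exact ⟨concept_over_of_isSub hN this.of_node.2.of_node.1,
      concept_over_of_isSub hN this.of_node.2.of_node.2⟩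
  | ri r s =>
    exact ⟨role_over_of_isSub hN this.of_node.2.of_node.1,
      role_over_of_isSub hN this.of_node.2.of_node.2⟩
  | func r => exact role_over_of_isSub hN this.of_node.2

end Names

/-! ## The decision procedure -/

/-- The oracles for query entailment and query evaluation. -/
abbrev oracles : Fin 2 → Set Data := fun j => (![oneTCQEntailment, oneTCQEvaluation] j).language

open Classical in
noncomputable def askEntailment (x : Data) : Data :=
  if x ∈ oneTCQEntailment.language then .node .nil .nil else .nil

open Classical in
noncomputable def askEvaluation (x : Data) : Data :=
  if x ∈ oneTCQEvaluation.language then .node .nil .nil else .nil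

theorem Problem.code_mem_language (P : Problem) (i : P.Inst) :
    P.coded.code i ∈ P.language ↔ P.Yes i := by
  constructor
  · rintro ⟨j, hj, h⟩
    rwa [← P.coded.code_inj h]
  · exact fun h => ⟨i, h, rfl⟩

theorem askEntailment_ne_nil (i : EntailmentInst) :
    askEntailment (code i) ≠ .nil ↔ OneTCQEntails i.S i.S i.T₁ i.T₂ := by
  have : code i ∈ oneTCQEntailment.language ↔ _ := Problem.code_mem_language oneTCQEntailment i
  refine Iff.trans ?_ this
  rw [askEntailment]
  split
  · next h => exact iff_of_true (by simp) h
  · next h => exact iff_of_false (by simp) h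

theorem askEvaluation_ne_nil (i : EvaluationInst) :
    askEvaluation (code i) ≠ .nil ↔ CertainAnswer i.T i.A i.q i.a := by
  have : code i ∈ oneTCQEvaluation.language ↔ _ := Problem.code_mem_language oneTCQEvaluation i
  refine Iff.trans ?_ this
  rw [askEvaluation]
  split
  · next h => exact iff_of_true (by simp) h
  · next h => exact iff_of_false (by simp) h

theorem computes_askEntailment : Computes oracles askEntailment := Computes.ask 0 Computes.id

theorem computes_askEvaluation : Computes oracles askEvaluation := Computes.ask 1 Computes.id

namespace Data

/-! Codes of concepts, statements, assertions and queries, in terms of the codes of their parts -/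

def atom (A : Data) : Data := .node (num 2) A

def exists' (r C : Data) : Data := .node (num 4) (.node r C)

def ci (C D : Data) : Data := .node (num 0) (.node C D)

/-- Assertions and query atoms are coded alike, so this code and that of role atoms serve both. -/
def conAtom (A a : Data) : Data := .node (num 0) (.node A a)

def roleAtom (r a b : Data) : Data := .node (num 1) (.node r (.node a b))

/-- The code of `[false]`. -/
def one : Data := .node .nil .nil

/-- The code of `[true]`. -/
def two : Data := .node (.node .nil .nil) .nil

def conQuery (B : Data) : Data := .node .nil (.node .nil (.node (conAtom B .nil) .nil))

def pairQuery (B α : Data) : Data :=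
  .node .nil (.node (.node one .nil) (.node (conAtom B one) (.node α .nil)))

/-- The question whether the first individual is a certain answer. -/
def evaluation (T A q : Data) : Data := .node T (.node A (.node q .nil))

end Data

open Classical in
/-- The tame version of a statement. The input is a pair of the name `B` and the statement. -/
noncomputable def tameStmtData (p : Data) : Data :=
  -- The tag of CIs is `num 0`, that is, `nil`. For a CI the oracle is asked whether ⊤ ⊑ D is
  -- contradictory, which replaces a recursion through D.
  if p.tl.hd = .nil then
    if askEvaluation (.evaluation (.node (.ci (.node .nil .nil) p.tl.tl.tl) .nil)
      (.node (.conAtom p.hd .nil) .nil) (.conQuery (.node .nil p.hd))) = .nil then p.tl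
    else .ci p.tl.tl.hd (.atom p.hd)
  else p.tl

def spreadData (c n a : Data) : Data :=
  .node (.ci (.atom c) (.atom n)) <|
  .node (.ci (.atom c) (.exists' (.node (.num 0) n) (.atom c))) <|
  .node (.ci (.atom c) (.exists' (.node (.num 1) n) (.atom c))) <|
  .node (.ci (.exists' (.node (.num 0) n) (.atom c)) (.atom c)) <|
  .node (.ci (.exists' (.node (.num 1) n) (.atom c)) (.atom c)) a

noncomputable def tameData (B N T : Data) : Data :=
  Data.fold spreadData B N (Data.fold (fun c x a => .node (tameStmtData (.node c x)) a) B T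
    (.node (.ci (.node .nil .nil) (.atom (.node .nil B))) .nil))

open Classical in
/-- If the second of two TBoxes yields the answer, then so does the first. -/
noncomputable def compareData (c A q : Data) : Data :=
  if askEvaluation (.evaluation c.tl.hd A q) = .nil then .one
  else askEvaluation (.evaluation c.hd A q)

open Classical in
/-- The comparison of functionality assertions for a role name and its inverse. -/
noncomputable def funcTest (p : Data) : Data :=
  if compareData p.hd (.node (.roleAtom p.tl .nil .one) (.node (.roleAtom p.tl .nil .two) .nil))
    (.conQuery p.hd.tl.tl) = .nil then .nil
  else compareData p.hd
    (.node (.roleAtom p.tl .one .nil) (.node (.roleAtom p.tl .two .nil) .nil))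
    (.conQuery p.hd.tl.tl)

open Classical in
/-- The comparison of inclusions of a role name in a role name and its inverse. -/
noncomputable def roleTest (p : Data) : Data :=
  if compareData p.hd.hd
    (.node (.roleAtom p.hd.tl .nil .one) (.node (.conAtom p.hd.hd.tl.tl .one) .nil))
    (.pairQuery p.hd.hd.tl.tl (.roleAtom p.tl .nil .one)) = .nil then .nil
  else compareData p.hd.hd
    (.node (.roleAtom p.hd.tl .nil .one) (.node (.conAtom p.hd.hd.tl.tl .one) .nil))
    (.pairQuery p.hd.hd.tl.tl (.roleAtom p.tl .one .nil))

noncomputable def roleTests (p : Data) : Data := Data.all roleTest (.node p.hd.hd p.tl) p.hd.tl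

open Classical in
/-- The answer for an input that is paired with a fresh name and the list of names. -/
noncomputable def answerData (e : Data) : Data :=
  if Data.all funcTest (.node e.hd.hd (.node e.hd.tl.hd e.tl.hd)) e.hd.tl.tl.tl = .nil then .nil
  else if Data.all roleTests (.node (.node e.hd.hd (.node e.hd.tl.hd e.tl.hd)) e.hd.tl.tl.tl)
    e.hd.tl.tl.tl = .nil then .nil
  else askEntailment (.node (tameData e.tl.hd e.tl.tl e.hd.hd)
    (.node (tameData e.tl.hd e.tl.tl e.hd.tl.hd)
      (.node (.node e.tl.hd (.node (.node .nil e.tl.hd) e.hd.tl.tl.hd)) e.hd.tl.tl.tl)))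

/-! ## Its running time -/

section Computes

open Computes

variable {ι : Type} {O : ι → Set Data} {f g h : Data → Data}

theorem Computes.atom (hf : Computes O f) : Computes O fun d => .atom (f d) :=
  (const _).node hf

theorem Computes.exists' (hf : Computes O f) (hg : Computes O g) :
    Computes O fun d => .exists' (f d) (g d) := (const _).node (hf.node hg)

theorem Computes.ci (hf : Computes O f) (hg : Computes O g) :
    Computes O fun d => .ci (f d) (g d) := (const _).node (hf.node hg)

theorem Computes.conAtom (hf : Computes O f) (hg : Computes O g) :
    Computes O fun d => .conAtom (f d) (g d) := (const _).node (hf.node hg)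

theorem Computes.roleAtom (hf : Computes O f) (hg : Computes O g) (hh : Computes O h) :
    Computes O fun d => .roleAtom (f d) (g d) (h d) := (const _).node (hf.node (hg.node hh))

theorem Computes.conQuery (hf : Computes O f) : Computes O fun d => .conQuery (f d) :=
  nil.node (nil.node ((hf.conAtom nil).node nil))

theorem Computes.pairQuery (hf : Computes O f) (hg : Computes O g) :
    Computes O fun d => .pairQuery (f d) (g d) :=
  nil.node ((const _).node ((hf.conAtom (const _)).node (hg.node nil)))

theorem Computes.evaluation (hf : Computes O f) (hg : Computes O g) (hh : Computes O h) :
    Computes O fun d => .evaluation (f d) (g d) (h d) := hf.node (hg.node (hh.node nil))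

theorem computes_tameStmtData : Computes oracles tameStmtData := by
  refine ite id.tl.hd id.tl (ite (computes_askEvaluation.comp ?_) ?_ id.tl)
  · exact (((const _).ci id.tl.tl.tl).node nil).evaluation ((id.hd.conAtom nil).node nil)
      (nil.node id.hd).conQuery
  · exact id.tl.tl.hd.ci id.hd.atom

theorem slowGrowth_spreadData : SlowGrowth spreadData := by
  have hc : Computes oracles fun d => .atom d.hd := id.hd.atom
  have hr : ∀ k, Computes oracles fun d => .exists' (.node (.num k) d.tl) (.atom d.hd) := fun k =>
    ((const _).node id.tl).exists' hc
  exact .node (hc.ci id.tl.atom) <| .node (hc.ci (hr 0)) <| .node (hc.ci (hr 1)) <|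
    .node ((hr 0).ci hc) <| .node ((hr 1).ci hc) .acc

theorem Computes.spreadData (hf : Computes O f) (hg : Computes O g) (hh : Computes O h) :
    Computes O fun d => spreadData (f d) (g d) (h d) := by
  have hr : ∀ k, Computes O fun d => .exists' (.node (.num k) (g d)) (.atom (f d)) := fun k =>
    ((const _).node hg).exists' hf.atom
  exact (hf.atom.ci hg.atom).node <| (hf.atom.ci (hr 0)).node <| (hf.atom.ci (hr 1)).node <|
    ((hr 0).ci hf.atom).node <| ((hr 1).ci hf.atom).node hh

theorem Computes.tameData (hf : Computes oracles f) (hg : Computes oracles g)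
    (hh : Computes oracles h) : Computes oracles fun d => tameData (f d) (g d) (h d) := by
  refine fold (id.hd.spreadData id.tl.hd id.tl.tl) slowGrowth_spreadData hf hg ?_
  refine fold ?_ (.node computes_tameStmtData .acc) hf hh ?_
  · exact (computes_tameStmtData.comp (id.hd.node id.tl.hd)).node id.tl.tl
  · exact ((const _).ci (nil.node hf).atom).node nil

theorem Computes.compareData (hf : Computes oracles f) (hg : Computes oracles g)
    (hh : Computes oracles h) : Computes oracles fun d => compareData (f d) (g d) (h d) :=
  ite (computes_askEvaluation.comp (hf.tl.hd.evaluation hg hh))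
    (computes_askEvaluation.comp (hf.hd.evaluation hg hh)) (const _)

theorem computes_funcTest : Computes oracles funcTest := by
  refine ite (id.hd.compareData ?_ id.hd.tl.tl.conQuery)
    (id.hd.compareData ?_ id.hd.tl.tl.conQuery) nil
  · exact (id.tl.roleAtom nil (const _)).node ((id.tl.roleAtom nil (const _)).node nil)
  · exact (id.tl.roleAtom (const _) nil).node ((id.tl.roleAtom (const _) nil).node nil)

theorem computes_roleTest : Computes oracles roleTest := by
  have hA : Computes oracles fun p : Data => .node (.roleAtom p.hd.tl .nil .one)
      (.node (.conAtom p.hd.hd.tl.tl .one) .nil) :=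
    (id.hd.tl.roleAtom nil (const _)).node ((id.hd.hd.tl.tl.conAtom (const _)).node nil)
  exact ite (id.hd.hd.compareData hA (id.hd.hd.tl.tl.pairQuery (id.tl.roleAtom nil (const _))))
    (id.hd.hd.compareData hA (id.hd.hd.tl.tl.pairQuery (id.tl.roleAtom (const _) nil))) nil

theorem computes_roleTests : Computes oracles roleTests :=
  Computes.all computes_roleTest (id.hd.hd.node id.tl) id.hd.tl

theorem computes_answerData : Computes oracles answerData := by
  have hc : Computes oracles fun e : Data => .node e.hd.hd (.node e.hd.tl.hd e.tl.hd) :=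
    id.hd.hd.node (id.hd.tl.hd.node id.tl.hd)
  refine ite (Computes.all computes_funcTest hc id.hd.tl.tl.tl)
    (ite (Computes.all computes_roleTests (hc.node id.hd.tl.tl.tl) id.hd.tl.tl.tl)
      (computes_askEntailment.comp ?_) nil) nil
  exact (id.tl.hd.tameData id.tl.tl id.hd.hd).node ((id.tl.hd.tameData id.tl.tl id.hd.tl.hd).node
    ((id.tl.hd.node ((nil.node id.tl.hd).node id.hd.tl.tl.hd)).node id.hd.tl.tl.tl))

end Computes

/-! ## Its correctness -/

section Correctness

variable {B : ConceptName} {N : List (List Bool)}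

open Classical in
theorem tameStmtData_eq (hX : false :: B ∉ N) {α : Stmt} (hα : α.Over (.ofNames N)) :
    tameStmtData (.node (code B) (code α)) = code (α.tame B) := by
  cases α with
  | ci C D =>
    let T : TBox := ⟨[.ci .top D], by simp⟩
    have h := hasBot_iff (T := T) (D := D) rfl hα.2 (B := B) (X := false :: B) hX (by simp)
    let i : EvaluationInst :=
      ⟨T, [.con B []], conQuery (false :: B), [], ⟨_, List.mem_singleton_self _, rfl⟩⟩
    have hask : _ ↔ CertainAnswer T [.con B []] (conQuery (false :: B)) [] := askEvaluation_ne_nil i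
    rw [← h] at hask
    refine (show tameStmtData (.node (code B) (code (Stmt.ci C D))) =
      if askEvaluation (code i) = .nil then code (Stmt.ci C D) else code (Stmt.ci C (.atom B))
      from if_pos rfl).trans ?_
    rw [Stmt.tame]
    split
    · next h₁ => rw [if_neg fun hbot => hask.2 hbot h₁]
    · next h₁ => rw [if_pos (hask.1 h₁)]
  | ri r s =>
    exact if_neg fun h => Data.noConfusion (show Data.node .nil .nil = .nil from h)
  | func r =>
    exact if_neg fun h => Data.noConfusion (show Data.node .nil (.node .nil .nil) = .nil from h)

theorem tameData_eq (hX : false :: B ∉ N) {T : TBox} (hT : T.Over (.ofNames N)) :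
    tameData (code B) (code N) (code T) = code (T.tame B (false :: B) N) := by
  have h₁ := Data.fold_codeList (g := fun c x a => .node (tameStmtData (.node c x)) a)
    (c := code B) (step := fun (l : List Stmt) α => α.tame B :: l) T.stmts
    (fun α hα m => by
      rw [tameStmtData_eq hX (hT α hα)]
      rfl) [.ci .top (.atom (false :: B))]
  have h₂ := Data.fold_codeList (g := spreadData) (c := code B)
    (step := fun l n => spread B n ++ l) N (fun n _ m => rfl)
    (T.stmts.foldl (fun l α => α.tame B :: l) [.ci .top (.atom (false :: B))])
  rw [← h₁] at h₂
  exact h₂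

open Classical in
theorem compareData_ne_nil (T₁ T₂ : TBox) (b : Data) (A : ABox) (q : OneTCQ) (h : [] ∈ A.inds) :
    compareData (.node (code T₁) (.node (code T₂) b)) (code A) (code q) ≠ .nil ↔
      (CertainAnswer T₂ A q [] → CertainAnswer T₁ A q []) := by
  have h₁ := askEvaluation_ne_nil ⟨T₁, A, q, [], h⟩
  have h₂ := askEvaluation_ne_nil ⟨T₂, A, q, [], h⟩
  change (if askEvaluation _ = .nil then _ else _) ≠ _ ↔ _
  dsimp only at h₁ h₂
  rw [← h₁, ← h₂]
  split
  · next h₃ => exact ⟨fun _ h => absurd h₃ h, fun _ => by simp [Data.one]⟩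
  · next h₃ => exact ⟨fun h _ => h, fun h => h h₃⟩

open Classical in
theorem ite_nil_ne_nil {x y : Data} :
    (if x = .nil then Data.nil else y) ≠ .nil ↔ x ≠ .nil ∧ y ≠ .nil := by
  split <;> simp_all

variable {T₁ T₂ : TBox}

theorem funcTest_ne_nil (hT₁ : T₁.Over (.ofNames N)) (hT₂ : T₂.Over (.ofNames N)) (hB : B ∉ N)
    (r : RoleName) :
    funcTest (.node (.node (code T₁) (.node (code T₂) (code B))) (code r)) ≠ .nil ↔
      (T₂.Entails (.func (.fwd r)) → T₁.Entails (.func (.fwd r))) ∧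
        (T₂.Entails (.func (.bwd r)) → T₁.Entails (.func (.bwd r))) := by
  rw [entails_func_iff hT₁ hB, entails_func_iff hT₂ hB, entails_func_iff hT₁ hB,
    entails_func_iff hT₂ hB, ← compareData_ne_nil T₁ T₂ (code B), ← compareData_ne_nil T₁ T₂ (code B)]
  · exact ite_nil_ne_nil
  · exact ⟨_, List.mem_cons_self, .inr rfl⟩
  · exact ⟨_, List.mem_cons_self, .inl rfl⟩

theorem roleTest_ne_nil (hT₁ : T₁.Over (.ofNames N)) (hT₂ : T₂.Over (.ofNames N)) (hB : B ∉ N)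
    (r s : RoleName) :
    roleTest (.node (.node (.node (code T₁) (.node (code T₂) (code B))) (code r)) (code s)) ≠ .nil ↔
      (T₂.Entails (.ri (.fwd r) (.fwd s)) → T₁.Entails (.ri (.fwd r) (.fwd s))) ∧
        (T₂.Entails (.ri (.fwd r) (.bwd s)) → T₁.Entails (.ri (.fwd r) (.bwd s))) := by
  rw [entails_ri_iff hT₁ hB, entails_ri_iff hT₂ hB, entails_ri_iff hT₁ hB,
    entails_ri_iff hT₂ hB, ← compareData_ne_nil T₁ T₂ (code B), ← compareData_ne_nil T₁ T₂ (code B)]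
  · exact ite_nil_ne_nil
  · exact ⟨_, List.mem_cons_self, .inl rfl⟩
  · exact ⟨_, List.mem_cons_self, .inl rfl⟩

/-- Hence only inclusions whose left-hand side is a role name have to be tested. -/
theorem TBox.entails_ri_inv {T : TBox} {r s : Role} (h : T.Entails (.ri r s)) :
    T.Entails (.ri r.inv s.inv) := fun I hI d e hde =>
  (I.role_inv s d e).2 (h I hI e d ((I.role_inv r d e).1 hde))

theorem answerData_ne_nil (i : EntailmentInst) :
    answerData (.node (code i) (freshAndNames (code i))) ≠ .nil ↔
      DeductivelyEntails i.S i.T₁ i.T₂ := by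
  obtain ⟨T₁, T₂, S⟩ := i
  obtain ⟨d, hd⟩ : ∃ d, d = code (EntailmentInst.mk T₁ T₂ S) := ⟨_, rfl⟩
  obtain ⟨N, hNd⟩ : ∃ N, N = visit d [] := ⟨_, rfl⟩
  -- Every collected name is shorter than the size of the input, so this string, and also the longer
  -- one used for X, is fresh.
  obtain ⟨B, hBd⟩ : ∃ B, B = List.replicate d.size false := ⟨_, rfl⟩
  have hN : ∀ y : Data, y.IsSub d → toName y ∈ N := fun y hy => hNd ▸ toName_mem_visit hy []
  have hlen : ∀ n ∈ N, n.length < d.size := fun n hn => by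
    rcases length_lt_of_mem_visit (hNd ▸ hn) with h | h
    · cases h
    · exact h
  have hB : B ∉ N := fun h => by simpa [hBd] using hlen _ h
  have hX : false :: B ∉ N := fun h => by
    have := hlen _ h
    simp [hBd] at this
  have hsub : d.IsSub d := .refl d
  nth_rw 1 [hd] at hsub
  have hT₁ : T₁.Over (.ofNames N) := tbox_over_of_isSub hN hsub.of_node.1
  have hT₂ : T₂.Over (.ofNames N) := tbox_over_of_isSub hN hsub.of_node.2.of_node.1
  have hS := hsub.of_node.2.of_node.2.of_node
  have hc : S.concepts ⊆ N := fun A hA => mem_of_isSub hN (isSub_of_mem hS.1 hA)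
  have hr : S.roles ⊆ N := fun r hr => mem_of_isSub hN (isSub_of_mem hS.2 hr)
  have hent := askEntailment_ne_nil
    ⟨T₁.tame B (false :: B) N, T₂.tame B (false :: B) N, S.extend B (false :: B)⟩
  rw [deductivelyEntails_iff hT₁ hT₂ hc hr hB hX (by simp), ← hent, freshAndNames, ← hd, ← hBd,
    ← hNd, hd]
  have hfunc := Data.all_ne_nil (t := funcTest)
    (c := .node (code T₁) (.node (code T₂) (code B))) S.roles
  have hrole := Data.all_ne_nil (t := roleTests)
    (c := .node (.node (code T₁) (.node (code T₂) (code B))) (code S.roles)) S.roles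
  have hrole' : ∀ r : RoleName, roleTests (.node (.node (.node (code T₁) (.node (code T₂) (code B)))
      (code S.roles)) (code r)) ≠ .nil ↔ _ := fun r => Data.all_ne_nil (t := roleTest)
    (c := .node (.node (code T₁) (.node (code T₂) (code B))) (code r)) S.roles
  simp only [funcTest_ne_nil hT₁ hT₂ hB] at hfunc
  simp only [hrole', roleTest_ne_nil hT₁ hT₂ hB] at hrole
  refine ite_nil_ne_nil.trans (and_congr (hfunc.trans ?_)
    (ite_nil_ne_nil.trans (and_congr (hrole.trans ?_) ?_)))
  · exact ⟨fun h r hr => by cases r; exacts [(h _ hr).1, (h _ hr).2],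
      fun h r hr => ⟨h (.fwd r) hr, h (.bwd r) hr⟩⟩
  · constructor
    · intro h r s hr hs
      have hfwd : ∀ (r : RoleName) (s : Role), r ∈ S.roles → s.Over S →
          T₂.Entails (.ri (.fwd r) s) → T₁.Entails (.ri (.fwd r) s) := fun r s hr hs => by
        cases s
        · exact (h r hr _ hs).1
        · exact (h r hr _ hs).2
      cases r with
      | fwd r => exact hfwd r s hr hs
      | bwd r =>
        intro h₂
        have := hfwd r s.inv hr (by simpa [Role.Over] using hs) (TBox.entails_ri_inv h₂)
        have := TBox.entails_ri_inv this
        rwa [Role.inv_inv] at this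
    · exact fun h r hr s hs => ⟨h (.fwd r) (.fwd s) hr hs, h (.fwd r) (.bwd s) hr hs⟩
  · change askEntailment (.node (tameData (code B) (code N) (code T₁))
      (.node (tameData (code B) (code N) (code T₂)) _)) ≠ _ ↔ _
    rw [tameData_eq hX hT₁, tameData_eq hX hT₂]
    rfl

end Correctness

end ELHIF

theorem mainTheorem9 :
    ELHIF.PolyTimeDecidableGiven ![ELHIF.oneTCQEntailment, ELHIF.oneTCQEvaluation]
      ELHIF.deductiveEntailment := by
  obtain ⟨p, -, h⟩ := ELHIF.computes_answerData.comp
    (ELHIF.Computes.id.node ELHIF.computes_freshAndNames)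
  -- Input and answer are both held in variable 0, so the in-place program is taken at that
  -- position.
  obtain ⟨c, hc⟩ := h 0
  refine ⟨c, p, fun i => ?_⟩
  obtain ⟨s, t, he, hs, -, ht⟩ := hc (.init (ELHIF.deductiveEntailment.coded.code i))
  refine ⟨s, t, he, ht, ?_⟩
  rw [hs]
  exact ELHIF.answerData_ne_nil i
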